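/- Let $d\in\mathbb N$, $G\in\mathrm{GL}_{1+d}(\mathbb R)$, and let $\mathcal P_0=\{0\}\times\mathbb R^d\subset\mathbb R^{1+d}$. Write $\pi(\xi_0,\xi)=\xi$, $\sigma(\xi)=(\sqrt{1-\|\xi\|^2},\xi)$ for $\|\xi\|\le 1$, $g=\pi\circ{}^tG\circ\sigma$, and $$J(\xi)=|\det dg(\xi)|^{-1},\qquad \tilde J(\tilde\xi)=\sum_{\|\eta\|<1,\ g(\eta)=\tilde\xi}J(\eta),$$ so that $\tilde J(g(\xi))=\sum_{\eta\in g^{-1}(g(\xi))}J(\eta)$ for $\|\xi\|<1$. For $\hbar>0$ let $\mathcal F_\hbar u(\xi)=\int_{\mathbb R^d} e^{-\frac i\hbar\langle x,\xi\rangle}u(x)\,dx$ and, with $\tilde X=(0,\tilde x)$, $$[V_G\phi](\tilde x)=\frac1{(2\pi\hbar)^d}\int_{\|\xi\|<1}e^{\frac i\hbar\langle G\tilde X,\sigma(\xi)\rangle}\phi(\xi)\,d\xi,\qquad U_G=V_G\mathcal F_\hbar .$$ Since $V_G$ is only considered microlocally, let $\chi$ be any real smooth function on $\mathbb R^d$ whose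 support contains no $\eta$ with $\|\eta\|\le1$ and $\sigma(\eta)\in G\mathcal P_0$, and set $V:=V_G\chi$ and $U:=V_G\chi\mathcal F_\hbar$. Two families $A_\hbar,B_\hbar$ of bounded operators on $L^2(\mathbb R^d)$ are called equal microlocally near a point $\rho$ of $\mathbb R^d\times\mathbb R^d$ if $\rho$ has a neighbourhood $W$ such that $\|\mathrm{Op}^w_\hbar(a)(A_\hbar-B_\hbar)\mathrm{Op}^w_\hbar(b)\|_{L^2\to L^2}=O(\hbar^\infty)$ as $\hbar\to0$ for all $a,b\in C^\infty_c(W)$, where $\mathrm{Op}^w_\hbar$ is the semiclassical Weyl quantization. Then $V$ and $U$ are bounded on $L^2(\mathbb R^d)$ for every $\hbar>0$; let $V^*$, $U^*$ be their adjoints. Let $\xi\in\mathbb R^d$ with $\|\xi\|<1$ and $\sigma(\xi)\notin G\mathcal P_0$. (1) If $\chi=1$ near every $\eta$ with $\|\eta\|\le1$ and $g(\eta)=g(\xi)$, then for every $x\in\mathbb R^d$, microlocally near $(x,g(\xi))$, $$VV^*=\frac1{(2\pi\hbar)^d}\mathcal F_\hbar^{-1}\tilde J\mathcal F_\hbar,\qquad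 UU^*=\mathcal F_\hbar^{-1}\tilde J\mathcal F_\hbar .$$ (2) If $\chi=1$ near $\xi$, then for every $x\in\mathbb R^d$, $$V^*V=\frac1{(2\pi\hbar)^d}J\ \text{ microlocally near }(\xi,x),\qquad U^*U=\mathcal F_\hbar^{-1}J\mathcal F_\hbar\ \text{ microlocally near }(x,\xi).$$ Here the multiplication operator $\tilde J$ (respectively $J$), whose symbol is only defined locally, stands for multiplication by any bounded measurable function that coincides with $\tilde J$ near $g(\xi)$ (respectively with $J$ near $\xi$). -/

import Mathlib

open MeasureTheory Topology
open scoped SchwartzMap ContDiff ENNReal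

noncomputable section

namespace AngularSpectrum

/-- The Euclidean space `ℝ^d`. -/
abbrev E (d : ℕ) := EuclideanSpace ℝ (Fin d)

/-- The Hilbert space `L²(ℝ^d)`. -/
abbrev L2 (d : ℕ) := Lp ℂ 2 (volume : Measure (E d))

/-- The lift `σ(ξ) = (√(1 - ‖ξ‖²), ξ)` to the right hemisphere (used for `‖ξ‖ ≤ 1`). -/
def sigma {d : ℕ} (ξ : E d) : E (d + 1) :=
  WithLp.toLp 2 (Fin.cons (Real.sqrt (1 - ‖ξ‖ ^ 2)) (fun j => ξ j))

/-- The point `G X̃` with `X̃ = (0, x̃)`. The range of this map is the hyperplane `G P₀`. -/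
def tilt {d : ℕ} (G : Matrix (Fin (d + 1)) (Fin (d + 1)) ℝ) (x : E d) : E (d + 1) :=
  WithLp.toLp 2 (G.mulVec (Fin.cons 0 (fun j => x j)))

/-- The map `g = π ∘ Gᵀ ∘ σ`, where `π` forgets the coordinate of index `0`. -/
def gMap {d : ℕ} (G : Matrix (Fin (d + 1)) (Fin (d + 1)) ℝ) (ξ : E d) : E d :=
  WithLp.toLp 2 (fun j => (G.transpose.mulVec (fun i => sigma ξ i)) j.succ)

/-- The Jacobian factor `J(ξ) = |det dg(ξ)|⁻¹`. -/
def jac {d : ℕ} (G : Matrix (Fin (d + 1)) (Fin (d + 1)) ℝ) (ξ : E d) : ℝ :=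
  |(fderiv ℝ (gMap G) ξ).det|⁻¹

/-- `J̃(ξ̃) = ∑ J(η)` over all `η` in the open unit ball such that `g(η) = ξ̃`
(there are at most two of them when `G` is invertible). -/
def jacSum {d : ℕ} (G : Matrix (Fin (d + 1)) (Fin (d + 1)) ℝ) (ξ' : E d) : ℝ :=
  ∑ᶠ η ∈ {η : E d | ‖η‖ < 1 ∧ gMap G η = ξ'}, jac G η

/-- The semiclassical Fourier transform. -/
def semiFourier {d : ℕ} (ħ : ℝ) (u : E d → ℂ) (ξ : E d) : ℂ :=
  ∫ x, Complex.exp (-(Complex.I / ħ) * (inner ℝ x ξ : ℝ)) * u x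

/-- The inverse semiclassical Fourier transform. -/
def semiFourierInv {d : ℕ} (ħ : ℝ) (φ : E d → ℂ) (x : E d) : ℂ :=
  (((2 * Real.pi * ħ) ^ d : ℝ) : ℂ)⁻¹ *
    ∫ ξ, Complex.exp ((Complex.I / ħ) * (inner ℝ x ξ : ℝ)) * φ ξ

/-- The operator `V_G χ`, in the region `‖ξ‖ < 1`. -/
def opV {d : ℕ} (G : Matrix (Fin (d + 1)) (Fin (d + 1)) ℝ) (χ : E d → ℝ) (ħ : ℝ)
    (φ : E d → ℂ) (x : E d) : ℂ :=
  (((2 * Real.pi * ħ) ^ d : ℝ) : ℂ)⁻¹ *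
    ∫ ξ in Metric.ball (0 : E d) 1,
      Complex.exp ((Complex.I / ħ) * (inner ℝ (tilt G x) (sigma ξ) : ℝ)) * (χ ξ * φ ξ)

/-- The operator `U_G`, with the cut-off `χ(ξ)` inserted in its amplitude, in the region
`‖ξ‖ < 1`. -/
def opU {d : ℕ} (G : Matrix (Fin (d + 1)) (Fin (d + 1)) ℝ) (χ : E d → ℝ) (ħ : ℝ)
    (u : E d → ℂ) (x : E d) : ℂ :=
  (((2 * Real.pi * ħ) ^ d : ℝ) : ℂ)⁻¹ *
    ∫ ξ in Metric.ball (0 : E d) 1, ∫ y,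
      Complex.exp ((Complex.I / ħ) *
        ((inner ℝ (tilt G x) (sigma ξ) - inner ℝ y ξ : ℝ) : ℂ)) * (χ ξ * u y)

/-- Multiplication by the function `c · m`. -/
def opMul {d : ℕ} (c : ℂ) (m : E d → ℝ) (φ : E d → ℂ) (ξ : E d) : ℂ :=
  c * (m ξ * φ ξ)

/-- The operator `c · F_ħ⁻¹ m F_ħ`. -/
def opFourierMul {d : ℕ} (ħ : ℝ) (c : ℂ) (m : E d → ℝ) (u : E d → ℂ) (x : E d) : ℂ :=
  c * semiFourierInv ħ (fun ξ => m ξ * semiFourier ħ u ξ) x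

/-- The semiclassical Weyl quantization of a symbol `a(x, θ)`. -/
def opWeyl {d : ℕ} (ħ : ℝ) (a : E d × E d → ℂ) (u : E d → ℂ) (x : E d) : ℂ :=
  (((2 * Real.pi * ħ) ^ d : ℝ) : ℂ)⁻¹ *
    ∫ θ, ∫ y, Complex.exp ((Complex.I / ħ) * (inner ℝ (x - y) θ : ℝ)) *
      (a ((1 / 2 : ℝ) • (x + y), θ) * u y)

/-- The bounded operator `T` on `L²(ℝ^d)` is given by the formula `K` on Schwartz functions.
Since these are dense, `K` determines `T`. -/
def IsGivenBy {d : ℕ} (T : L2 d →L[ℂ] L2 d) (K : (E d → ℂ) → E d → ℂ) : Prop :=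
  ∀ u : 𝓢(E d, ℂ), (T (u.toLp 2 volume) : E d → ℂ) =ᵐ[volume] K u

/-- A smooth symbol supported in a compact subset of `W`. -/
def IsSymbolIn {d : ℕ} (W : Set (E d × E d)) (a : E d × E d → ℂ) : Prop :=
  ContDiff ℝ ∞ a ∧ HasCompactSupport a ∧ tsupport a ⊆ W

/-- Microlocal equality, near the point `ρ` of phase space, of two `ħ`-dependent families of
bounded operators on `L²(ℝ^d)`: for all symbols `a`, `b` supported close to `ρ`, one has
`Op_ħ^w(a) (A_ħ - B_ħ) Op_ħ^w(b) = O(ħ^∞)` in operator norm. -/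
def MicrolocallyEq {d : ℕ} (A B : ℝ → L2 d →L[ℂ] L2 d) (ρ : E d × E d) : Prop :=
  ∃ W ∈ 𝓝 ρ, ∀ a b : E d × E d → ℂ, IsSymbolIn W a → IsSymbolIn W b →
    ∃ P Q : ℝ → L2 d →L[ℂ] L2 d,
      (∀ ħ : ℝ, 0 < ħ → IsGivenBy (P ħ) (opWeyl ħ a) ∧ IsGivenBy (Q ħ) (opWeyl ħ b)) ∧
      ∀ N : ℕ, ∃ C ħ₀ : ℝ, 0 < ħ₀ ∧ ∀ ħ : ℝ, 0 < ħ → ħ < ħ₀ →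
        ‖(P ħ).comp ((A ħ - B ħ).comp (Q ħ))‖ ≤ C * ħ ^ N

/-- The family `A` is, microlocally near `ρ`, the family of bounded operators given by the
formulas `K ħ`. -/
def IsMicrolocally {d : ℕ} (A : ℝ → L2 d →L[ℂ] L2 d) (K : ℝ → (E d → ℂ) → E d → ℂ)
    (ρ : E d × E d) : Prop :=
  ∃ B : ℝ → L2 d →L[ℂ] L2 d, (∀ ħ : ℝ, 0 < ħ → IsGivenBy (B ħ) (K ħ)) ∧ MicrolocallyEq A B ρ

/-- A smooth cut-off whose support does not meet the frequencies `η` of the closed unit ball at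
which `σ(η)` lies in the hyperplane `G P₀`. -/
def IsCutoff {d : ℕ} (G : Matrix (Fin (d + 1)) (Fin (d + 1)) ℝ) (χ : E d → ℝ) : Prop :=
  ContDiff ℝ ∞ χ ∧ ∀ η ∈ tsupport χ, ‖η‖ ≤ 1 → sigma η ∉ Set.range (tilt G)

/-- A bounded measurable function `m` that coincides with the function `j` near `ξ`. -/
def IsLocalVersion {d : ℕ} (j m : E d → ℝ) (ξ : E d) : Prop :=
  Measurable m ∧ (∃ C : ℝ, ∀ η, |m η| ≤ C) ∧ ∀ᶠ η in 𝓝 ξ, m η = j η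

end AngularSpectrum

end

open AngularSpectrum

noncomputable section

namespace AngularSpectrum

open scoped NNReal FourierTransform

variable {d : ℕ}

/-! The phase satisfies `⟨G X̃, σ(ξ)⟩ = ⟨x̃, g(ξ)⟩` (`inner_tilt_sigma`). Hence, with `c =
(2πħ)^{-d}`, `F = fourierL2 ħ` and the weighted composition `C ψ = χ · (ψ ∘ g)` on the unit ball,
one has exactly `V = c (C F)^*` (`adjoint_compOp_fourierL2_ae`). Since `c F F^* = 1`, pure algebra
gives `VV^* = c² F^* C^*C F`, `UU^* = c F^* C^*C F`, `V^*V = c C C^*` and `U^*U = c F^* C C^* F`.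
The operators `C^*C` and `C C^*` do not depend on `ħ`, so no stationary phase is needed: both are
computed by the change of variables `y = g(η)`.

The geometry rests on the linear form `hyperForm`, which vanishes on `G P₀`. On the open ball, `√(1
- ‖η‖²) · det dg(η)` equals this form at `σ(η)` (`sqrt_mul_det_fderiv_gMap`), and `g` is injective
on each side of `G P₀` (`eq_of_gMap_eq`). The cut-off condition therefore bounds `χ²` by a multiple
of `|det dg|`, which makes `C` bounded. Where `χ = 1` on whole fibers, `C^*C` is multiplication by
`J̃`, with one term from each side of `G P₀` (`exists_localized_adjoint_comp`). Between cut-offs to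
a small set near `ξ`, where `g` is injective and `χ = 1`, `C C^*` is multiplication by `J`
(`exists_localized_comp_adjoint`).

It remains to pass from sharp cut-offs to Weyl operators. The kernel of a Weyl operator decays
rapidly off the diagonal, so an `ħ`-independent operator that vanishes between the cut-offs is
`O(ħ^∞)` between Weyl operators localized inside (`exists_norm_weylL2_comp_le`). Localization in
frequency reduces to localization in position because `F` rotates Weyl symbols exactly
(`fourierL2_comp_weylL2`). -/

/-! ### Weighted composition operators on `L²` -/

/-- The weight `k` and the map `g` define a bounded operator `ψ ↦ k · (ψ ∘ g)` on `L²(ℝ^d)`. -/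
structure IsCompBounded (k : E d → ℝ) (g : E d → E d) (C : ℝ≥0) : Prop where
  measurable_weight : Measurable k
  measurable_map : Measurable g
  lintegral_le : ∀ f : E d → ℝ≥0∞, Measurable f → ∫⁻ η, ‖k η‖ₑ ^ 2 * f (g η) ≤ C ^ 2 * ∫⁻ y, f y

/-- Testing the bound on the indicator of a null set shows that its preimage under `g` is null off
the zeros of `k`. This is what makes `k · (ψ ∘ g)` independent of the representative of `ψ`. -/
theorem IsCompBounded.ae_comp {k : E d → ℝ} {g : E d → E d} {C : ℝ≥0} (h : IsCompBounded k g C)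
    {p : E d → Prop} (hp : ∀ᵐ y, p y) : ∀ᵐ η, k η ≠ 0 → p (g η) := by
  obtain ⟨N, hN, hNm, hN0⟩ := exists_measurable_superset_of_null (ae_iff.1 hp)
  have h1 := h.lintegral_le (N.indicator 1) (measurable_one.indicator hNm)
  rw [lintegral_indicator_one hNm, hN0, mul_zero, nonpos_iff_eq_zero, lintegral_eq_zero_iff] at h1
  · filter_upwards [h1] with η hη hk
    by_contra hpη
    have : g η ∈ N := hN hpη
    simp [this, hk] at hη
  · exact (h.measurable_weight.enorm.pow_const 2).mul
      ((measurable_one.indicator hNm).comp h.measurable_map)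

theorem IsCompBounded.aestronglyMeasurable {k : E d → ℝ} {g : E d → E d} {C : ℝ≥0}
    (h : IsCompBounded k g C) (ψ : L2 d) :
    AEStronglyMeasurable (fun η => (k η : ℂ) * ψ (g η)) volume :=
  ((Complex.measurable_ofReal.comp h.measurable_weight).mul
    ((Lp.stronglyMeasurable ψ).measurable.comp h.measurable_map)).aestronglyMeasurable

theorem IsCompBounded.eLpNorm_le {k : E d → ℝ} {g : E d → E d} {C : ℝ≥0}
    (h : IsCompBounded k g C) (ψ : L2 d) :
    eLpNorm (fun η => (k η : ℂ) * ψ (g η)) 2 volume ≤ C * eLpNorm ψ 2 volume := by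
  have h1 := h.lintegral_le (fun y => ‖ψ y‖ₑ ^ 2)
    ((Lp.stronglyMeasurable ψ).measurable.enorm.pow_const 2)
  rw [← ENNReal.rpow_le_rpow_iff (z := 2) (by norm_num), ENNReal.mul_rpow_of_nonneg _ _ (by norm_num)]
  have key : ∀ f : E d → ℂ, eLpNorm f 2 volume ^ (2 : ℝ) = ∫⁻ x, ‖f x‖ₑ ^ 2 := by
    intro f
    have := eLpNorm_nnreal_pow_eq_lintegral (f := f) (μ := (volume : Measure (E d))) (p := 2) (by norm_num)
    simpa using this
  rw [key, key]
  have h2 : ∀ x, ‖(k x : ℂ)‖ₑ = ‖k x‖ₑ := fun x => by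
    rw [← ofReal_norm, ← ofReal_norm, Complex.norm_real]
  simpa [enorm_mul, mul_pow, h2] using h1

theorem IsCompBounded.memLp {k : E d → ℝ} {g : E d → E d} {C : ℝ≥0}
    (h : IsCompBounded k g C) (ψ : L2 d) :
    MemLp (fun η => (k η : ℂ) * ψ (g η)) 2 volume :=
  ⟨h.aestronglyMeasurable ψ, (h.eLpNorm_le ψ).trans_lt
    (ENNReal.mul_lt_top ENNReal.coe_lt_top (Lp.eLpNorm_lt_top ψ))⟩

/-- The weighted composition operator `ψ ↦ k · (ψ ∘ g)`. -/
def compOp {k : E d → ℝ} {g : E d → E d} {C : ℝ≥0} (h : IsCompBounded k g C) : L2 d →L[ℂ] L2 d :=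
  LinearMap.mkContinuous
    { toFun := fun ψ => (h.memLp ψ).toLp
      map_add' := fun ψ φ => by
        rw [← MemLp.toLp_add]
        refine MemLp.toLp_congr _ _ ?_
        filter_upwards [h.ae_comp (Lp.coeFn_add ψ φ)] with η hη
        by_cases hk : k η = 0
        · simp [hk]
        · rw [hη hk, Pi.add_apply, mul_add, Pi.add_apply]
      map_smul' := fun c ψ => by
        rw [RingHom.id_apply, ← MemLp.toLp_const_smul]
        refine MemLp.toLp_congr _ _ ?_
        filter_upwards [h.ae_comp (Lp.coeFn_smul c ψ)] with η hη
        by_cases hk : k η = 0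
        · simp [hk]
        · simp [hη hk, mul_left_comm] }
    C (fun ψ => by
      have h1 := h.eLpNorm_le ψ
      simp only [LinearMap.coe_mk, AddHom.coe_mk, Lp.norm_toLp]
      refine (ENNReal.toReal_mono (ENNReal.mul_lt_top ENNReal.coe_lt_top
        (Lp.eLpNorm_lt_top ψ)).ne h1).trans_eq ?_
      simp [Lp.norm_def])

theorem compOp_ae {k : E d → ℝ} {g : E d → E d} {C : ℝ≥0} (h : IsCompBounded k g C) (ψ : L2 d) :
    compOp h ψ =ᵐ[volume] fun η => (k η : ℂ) * ψ (g η) :=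
  (h.memLp ψ).coeFn_toLp

theorem isCompBounded_id {m : E d → ℝ} (hm : Measurable m) {C : ℝ≥0} (hC : ∀ η, |m η| ≤ C) :
    IsCompBounded m id C := by
  refine ⟨hm, measurable_id, fun f hf => ?_⟩
  rw [← lintegral_const_mul _ hf]
  refine lintegral_mono fun η => ?_
  simp only [id]
  gcongr
  rw [← ofReal_norm, Real.norm_eq_abs]
  exact (ENNReal.ofReal_le_ofReal (hC η)).trans_eq (by simp)

/-- Restriction to a measurable set, as an operator on `L²(ℝ^d)`. -/
def cutOp {S : Set (E d)} (hS : MeasurableSet S) : L2 d →L[ℂ] L2 d :=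
  compOp (isCompBounded_id (m := S.indicator 1) (measurable_one.indicator hS) (C := 1)
    (fun η => by by_cases h : η ∈ S <;> simp [h]))

theorem cutOp_ae {S : Set (E d)} (hS : MeasurableSet S) (ψ : L2 d) :
    cutOp hS ψ =ᵐ[volume] S.indicator ψ := by
  filter_upwards [compOp_ae (isCompBounded_id (m := S.indicator 1) (measurable_one.indicator hS)
    (C := 1) (fun η => by by_cases h : η ∈ S <;> simp [h])) ψ] with η hη
  unfold cutOp
  rw [hη]
  by_cases h : η ∈ S <;> simp [h]

theorem cutOp_add_cutOp_compl {S : Set (E d)} (hS : MeasurableSet S) :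
    cutOp hS + cutOp hS.compl = ContinuousLinearMap.id ℂ (L2 d) := by
  ext1 ψ
  refine Lp.ext ?_
  filter_upwards [Lp.coeFn_add (cutOp hS ψ) (cutOp hS.compl ψ), cutOp_ae hS ψ,
    cutOp_ae hS.compl ψ] with η h1 h2 h3
  simp only [_root_.add_apply, h1, Pi.add_apply, h2, h3, ContinuousLinearMap.id_apply]
  by_cases h : η ∈ S <;> simp [h]

theorem norm_compOp_le {k : E d → ℝ} {g : E d → E d} {C : ℝ≥0} (h : IsCompBounded k g C) :
    ‖compOp h‖ ≤ C :=
  LinearMap.mkContinuous_norm_le _ C.2 _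

theorem norm_cutOp_le {S : Set (E d)} (hS : MeasurableSet S) : ‖cutOp hS‖ ≤ 1 :=
  (norm_compOp_le _).trans_eq (by simp)

theorem inner_eq_integral (φ ψ : L2 d) :
    inner ℂ φ ψ = ∫ x, (starRingEnd ℂ) (φ x) * ψ x := by
  rw [L2.inner_def]
  simp [RCLike.inner_apply, mul_comm]

theorem integrable_conj_mul (φ ψ : L2 d) :
    Integrable (fun x => (starRingEnd ℂ) (φ x) * ψ x) volume := by
  have := L2.integrable_inner (𝕜 := ℂ) φ ψ
  simpa [RCLike.inner_apply, mul_comm] using this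

/-! ### Operators with a dominated continuous kernel -/

/-- A continuous kernel dominated by a product `C k(x) k(y)` with `k ∈ L²`. -/
structure IsDominatedKernel (K : E d → E d → ℂ) (k : E d → ℝ) (C : ℝ) : Prop where
  continuous : Continuous (Function.uncurry K)
  memLp : MemLp k 2 volume
  weight_nonneg : ∀ x, 0 ≤ k x
  nonneg : 0 ≤ C
  le : ∀ x y, ‖K x y‖ ≤ C * (k x * k y)

theorem integrable_mul_L2 {k : E d → ℝ} (hk : MemLp k 2 volume) (u : L2 d) :
    Integrable (fun y => k y * ‖u y‖) volume := 
  MemLp.integrable_mul hk (Lp.memLp u).norm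

theorem integral_mul_norm_le {k : E d → ℝ} (hk : MemLp k 2 volume) (hk0 : ∀ y, 0 ≤ k y) (u : L2 d) :
    ∫ y, k y * ‖u y‖ ≤ (eLpNorm k 2 volume).toReal * ‖u‖ := by
  have := integral_mul_le_Lp_mul_Lq_of_nonneg (μ := (volume : Measure (E d)))
    (p := 2) (q := 2) (by constructor <;> norm_num) (f := k) (g := fun y => ‖u y‖) (ae_of_all _ hk0)
    (ae_of_all _ fun y => norm_nonneg _) (by simpa using hk) (by simpa using (Lp.memLp u).norm)
  refine this.trans_eq ?_
  rw [Lp.norm_def, hk.eLpNorm_eq_integral_rpow_norm (by norm_num) (by norm_num),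
    (Lp.memLp u).eLpNorm_eq_integral_rpow_norm (by norm_num) (by norm_num),
    ENNReal.toReal_ofReal (by positivity), ENNReal.toReal_ofReal (by positivity)]
  simp [abs_of_nonneg, hk0]

/-- Cauchy–Schwarz against the weight `k`. It is phrased for an operator, not a kernel, so that it
also applies after composition with `cutOp`. -/
theorem norm_le_of_ae_le_weight {k : E d → ℝ} (hk : MemLp k 2 volume) (hk0 : ∀ y, 0 ≤ k y)
    (T : L2 d →L[ℂ] L2 d) {C : ℝ} (hC : 0 ≤ C)
    (h : ∀ u : L2 d, ∀ᵐ x, ‖T u x‖ ≤ C * k x * ∫ y, k y * ‖u y‖) :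
    ‖T‖ ≤ C * (eLpNorm k 2 volume).toReal ^ 2 := by
  refine T.opNorm_le_bound (by positivity) fun u => ?_
  have hI : 0 ≤ ∫ y, k y * ‖u y‖ := integral_nonneg fun y => mul_nonneg (hk0 y) (norm_nonneg _)
  have h1 : ‖T u‖ ≤ (C * ∫ y, k y * ‖u y‖) * ‖hk.toLp k‖ := by
    refine Lp.norm_le_mul_norm_of_ae_le_mul ?_
    filter_upwards [h u, hk.coeFn_toLp] with x hx hx2
    rw [hx2, Real.norm_of_nonneg (hk0 x)]
    linarith [hx, mul_right_comm C (k x) (∫ y, k y * ‖u y‖)]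
  rw [Lp.norm_toLp] at h1
  calc ‖T u‖ ≤ _ := h1
    _ ≤ (C * ((eLpNorm k 2 volume).toReal * ‖u‖)) * (eLpNorm k 2 volume).toReal := by
        gcongr
        exact integral_mul_norm_le hk hk0 u
    _ = _ := by ring

theorem IsDominatedKernel.integrable {K : E d → E d → ℂ} {k : E d → ℝ} {C : ℝ}
    (h : IsDominatedKernel K k C) (u : L2 d) (x : E d) : Integrable (fun y => K x y * u y) := by
  refine ((integrable_mul_L2 h.memLp u).const_mul (C * k x)).mono' ?_ (ae_of_all _ fun y => ?_)
  · exact (h.continuous.comp (by fun_prop : Continuous fun y => (x, y))).aestronglyMeasurable.mul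
      (Lp.aestronglyMeasurable u)
  · rw [norm_mul]
    calc _ ≤ C * (k x * k y) * ‖u y‖ := by gcongr; exact h.le x y
      _ = _ := by ring

theorem IsDominatedKernel.norm_integral_le {K : E d → E d → ℂ} {k : E d → ℝ} {C : ℝ}
    (h : IsDominatedKernel K k C) (u : L2 d) (x : E d) :
    ‖∫ y, K x y * u y‖ ≤ C * k x * ∫ y, k y * ‖u y‖ := by
  rw [← integral_const_mul]
  refine norm_integral_le_of_norm_le ((integrable_mul_L2 h.memLp u).const_mul (C * k x))
    (ae_of_all _ fun y => ?_)
  rw [norm_mul]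
  calc _ ≤ C * (k x * k y) * ‖u y‖ := by gcongr; exact h.le x y
      _ = _ := by ring

theorem IsDominatedKernel.memLp_integral {K : E d → E d → ℂ} {k : E d → ℝ} {C : ℝ}
    (h : IsDominatedKernel K k C) (u : L2 d) : MemLp (fun x => ∫ y, K x y * u y) 2 volume := by
  refine MemLp.of_le_mul (c := C * ∫ y, k y * ‖u y‖) h.memLp ?_ (ae_of_all _ fun x => ?_)
  · refine StronglyMeasurable.aestronglyMeasurable ?_
    refine StronglyMeasurable.integral_prod_right (f := fun x y => K x y * u y) ?_
    exact (h.continuous.measurable.mul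
      ((Lp.stronglyMeasurable u).measurable.comp measurable_snd)).stronglyMeasurable
  · rw [Real.norm_of_nonneg (h.weight_nonneg x)]
    refine (h.norm_integral_le u x).trans_eq (by ring)

theorem IsDominatedKernel.norm_toLp_le {K : E d → E d → ℂ} {k : E d → ℝ} {C : ℝ}
    (h : IsDominatedKernel K k C) (u : L2 d) :
    ‖(h.memLp_integral u).toLp‖ ≤ C * (eLpNorm k 2 volume).toReal ^ 2 * ‖u‖ := by
  have hI : 0 ≤ ∫ y, k y * ‖u y‖ :=
    integral_nonneg fun y => mul_nonneg (h.weight_nonneg y) (norm_nonneg _)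
  have h1 : ‖(h.memLp_integral u).toLp‖ ≤ (C * ∫ y, k y * ‖u y‖) * ‖h.memLp.toLp k‖ := by
    refine Lp.norm_le_mul_norm_of_ae_le_mul ?_
    filter_upwards [(h.memLp_integral u).coeFn_toLp, h.memLp.coeFn_toLp] with x hx hx2
    rw [hx2, hx, Real.norm_of_nonneg (h.weight_nonneg x)]
    exact (h.norm_integral_le u x).trans_eq (by ring)
  rw [Lp.norm_toLp k h.memLp] at h1
  have h0 := h.nonneg
  calc _ ≤ _ := h1
    _ ≤ (C * ((eLpNorm k 2 volume).toReal * ‖u‖)) * (eLpNorm k 2 volume).toReal := by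
        gcongr
        exact integral_mul_norm_le h.memLp h.weight_nonneg u
    _ = _ := by ring

/-- The operator on `L²(ℝ^d)` with a dominated continuous kernel. -/
def kernelOp {K : E d → E d → ℂ} {k : E d → ℝ} {C : ℝ} (h : IsDominatedKernel K k C) :
    L2 d →L[ℂ] L2 d :=
  LinearMap.mkContinuous
    { toFun := fun u => (h.memLp_integral u).toLp
      map_add' := fun u v => by
        rw [← MemLp.toLp_add]
        refine MemLp.toLp_congr _ _ (ae_of_all _ fun x => ?_)
        rw [Pi.add_apply, ← integral_add (h.integrable u x) (h.integrable v x)]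
        refine integral_congr_ae ?_
        filter_upwards [Lp.coeFn_add u v] with y hy
        rw [hy, Pi.add_apply, mul_add]
      map_smul' := fun c u => by
        rw [RingHom.id_apply, ← MemLp.toLp_const_smul]
        refine MemLp.toLp_congr _ _ (ae_of_all _ fun x => ?_)
        rw [Pi.smul_apply, smul_eq_mul, ← integral_const_mul]
        refine integral_congr_ae ?_
        filter_upwards [Lp.coeFn_smul c u] with y hy
        rw [hy, Pi.smul_apply, smul_eq_mul, mul_left_comm] }
    (C * (eLpNorm k 2 volume).toReal ^ 2) h.norm_toLp_le

theorem kernelOp_ae {K : E d → E d → ℂ} {k : E d → ℝ} {C : ℝ} (h : IsDominatedKernel K k C)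
    (u : L2 d) : kernelOp h u =ᵐ[volume] fun x => ∫ y, K x y * u y :=
  (h.memLp_integral u).coeFn_toLp

theorem norm_kernelOp_le {K : E d → E d → ℂ} {k : E d → ℝ} {C C' : ℝ}
    (h : IsDominatedKernel K k C) (h' : IsDominatedKernel K k C') :
    ‖kernelOp h‖ ≤ C' * (eLpNorm k 2 volume).toReal ^ 2 := by
  refine norm_le_of_ae_le_weight h.memLp h.weight_nonneg _ h'.nonneg fun u => ?_
  filter_upwards [kernelOp_ae h u] with x hx
  rw [hx]
  exact h'.norm_integral_le u x

/-- The gain comes from using the better constant `C'` only for `x ∈ S`; off-diagonal decay of a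
kernel enters operator norms through this and its mirror image. -/
theorem norm_cutOp_comp_kernelOp_le {K : E d → E d → ℂ} {k : E d → ℝ} {C C' : ℝ}
    (h : IsDominatedKernel K k C) {S : Set (E d)} (hS : MeasurableSet S) (hC' : 0 ≤ C')
    (hle : ∀ x ∈ S, ∀ y, ‖K x y‖ ≤ C' * (k x * k y)) :
    ‖(cutOp hS).comp (kernelOp h)‖ ≤ C' * (eLpNorm k 2 volume).toReal ^ 2 := by
  refine norm_le_of_ae_le_weight h.memLp h.weight_nonneg _ hC' fun u => ?_
  filter_upwards [kernelOp_ae h u, cutOp_ae hS (kernelOp h u)] with x hx hx2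
  rw [ContinuousLinearMap.comp_apply, hx2]
  have hI : 0 ≤ ∫ y, k y * ‖u y‖ :=
    integral_nonneg fun y => mul_nonneg (h.weight_nonneg y) (norm_nonneg _)
  by_cases hxS : x ∈ S
  · rw [Set.indicator_of_mem hxS, hx, ← integral_const_mul]
    refine norm_integral_le_of_norm_le ((integrable_mul_L2 h.memLp u).const_mul (C' * k x))
      (ae_of_all _ fun y => ?_)
    rw [norm_mul]
    calc _ ≤ C' * (k x * k y) * ‖u y‖ := by gcongr; exact hle x hxS y
      _ = _ := by ring
  · rw [Set.indicator_of_notMem hxS, norm_zero]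
    have := h.weight_nonneg x
    positivity

theorem norm_kernelOp_comp_cutOp_le {K : E d → E d → ℂ} {k : E d → ℝ} {C C' : ℝ}
    (h : IsDominatedKernel K k C) {S : Set (E d)} (hS : MeasurableSet S) (hC' : 0 ≤ C')
    (hle : ∀ x, ∀ y ∈ S, ‖K x y‖ ≤ C' * (k x * k y)) :
    ‖(kernelOp h).comp (cutOp hS)‖ ≤ C' * (eLpNorm k 2 volume).toReal ^ 2 := by
  refine norm_le_of_ae_le_weight h.memLp h.weight_nonneg _ hC' fun u => ?_
  filter_upwards [kernelOp_ae h (cutOp hS u)] with x hx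
  rw [ContinuousLinearMap.comp_apply, hx, ← integral_const_mul]
  refine norm_integral_le_of_norm_le ((integrable_mul_L2 h.memLp u).const_mul (C' * k x)) ?_
  filter_upwards [cutOp_ae hS u] with y hy
  rw [hy, norm_mul]
  by_cases hyS : y ∈ S
  · rw [Set.indicator_of_mem hyS]
    calc _ ≤ C' * (k x * k y) * ‖u y‖ := by gcongr; exact hle x y hyS
      _ = _ := by ring
  · rw [Set.indicator_of_notMem hyS, norm_zero, mul_zero]
    have := h.weight_nonneg x
    have := h.weight_nonneg y
    positivity

/-! ### The semiclassical Fourier transform on `L²` -/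

theorem map_smul_volume {r : ℝ} (hr : r ≠ 0) :
    Measure.map (fun ξ : E d => r • ξ) volume = ENNReal.ofReal |(r ^ d)⁻¹| • volume := by
  have := Measure.map_addHaar_smul (volume : Measure (E d)) hr
  simpa using this

/-- The dilation has Jacobian factor `|r|^{-d}`; its square root appears because the constant is
squared in `IsCompBounded`. -/
theorem isCompBounded_smul {r : ℝ} (hr : r ≠ 0) :
    IsCompBounded (fun _ => 1) (fun ξ : E d => r • ξ) (Real.sqrt |(r ^ d)⁻¹|).toNNReal := by
  refine ⟨measurable_const, measurable_const_smul r, fun f hf => ?_⟩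
  have h1 : ∫⁻ ξ : E d, f (r • ξ) = ENNReal.ofReal |(r ^ d)⁻¹| * ∫⁻ y, f y := by
    rw [← lintegral_map hf (measurable_const_smul r), map_smul_volume hr, lintegral_smul_measure,
      smul_eq_mul]
  have h2 : (((Real.sqrt |(r ^ d)⁻¹|).toNNReal : ℝ≥0∞)) ^ 2 = ENNReal.ofReal |(r ^ d)⁻¹| := by
    change ENNReal.ofReal _ ^ 2 = _
    rw [← ENNReal.ofReal_pow (Real.sqrt_nonneg _), Real.sq_sqrt (abs_nonneg _)]
  simp only [enorm_one, one_pow, one_mul]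
  rw [h1, h2]

/-- The semiclassical Fourier transform on `L²(ℝ^d)` (zero for `ħ = 0`). -/
def fourierL2 (ħ : ℝ) : L2 d →L[ℂ] L2 d :=
  if h : (2 * Real.pi * ħ)⁻¹ = 0 then 0 else
    (compOp (isCompBounded_smul h)).comp
      (Lp.fourierTransformₗᵢ (E d) ℂ).toLinearIsometry.toContinuousLinearMap

theorem semiFourier_eq {ħ : ℝ} (u : E d → ℂ) (ξ : E d) :
    semiFourier ħ u ξ = 𝓕 u ((2 * Real.pi * ħ)⁻¹ • ξ) := by
  rw [Real.fourier_eq']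
  unfold semiFourier
  refine integral_congr_ae (ae_of_all _ fun x => ?_)
  simp only [smul_eq_mul, inner_smul_right]
  congr 2
  push_cast
  have : (Real.pi : ℂ) ≠ 0 := by exact_mod_cast Real.pi_ne_zero
  -- For `ħ = 0` division by zero makes both phases vanish.
  by_cases h : (ħ : ℂ) = 0
  · simp [h]
  · field_simp

theorem fourierL2_ae {ħ : ℝ} (hħ : ħ ≠ 0) (u : L2 d) :
    fourierL2 ħ u =ᵐ[volume] fun ξ => (𝓕 u : L2 d) ((2 * Real.pi * ħ)⁻¹ • ξ) := by
  have h : ¬ (2 * Real.pi * ħ)⁻¹ = 0 := by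
    simp [Real.pi_ne_zero, hħ]
  rw [fourierL2, dif_neg h]
  filter_upwards [compOp_ae (isCompBounded_smul h) (𝓕 u : L2 d)] with ξ hξ
  refine Eq.trans hξ ?_
  simp

theorem fourierL2_toLp_ae {ħ : ℝ} (hħ : ħ ≠ 0) (u : 𝓢(E d, ℂ)) :
    fourierL2 ħ (u.toLp 2 volume) =ᵐ[volume] semiFourier ħ u := by
  have h : ¬ (2 * Real.pi * ħ)⁻¹ = 0 := by
    simp [Real.pi_ne_zero, hħ]
  filter_upwards [fourierL2_ae hħ (u.toLp 2 volume),
    (isCompBounded_smul h).ae_comp ((𝓕 u).coeFn_toLp 2 volume)] with ξ h1 h2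
  rw [h1, SchwartzMap.toLp_fourier_eq, h2 (by simp), semiFourier_eq, SchwartzMap.fourier_coe]

/-- Plancherel for the unitary normalization; the dilation by `(2πħ)⁻¹` contributes the constant. -/
theorem inner_fourierL2 {ħ : ℝ} (hħ : ħ ≠ 0) (u v : L2 d) :
    inner ℂ (fourierL2 ħ u) (fourierL2 ħ v) = ((2 * Real.pi * |ħ|) ^ d : ℝ) * inner ℂ u v := by
  rw [← Lp.inner_fourier_eq u v, inner_eq_integral, inner_eq_integral]
  have h1 : ∫ x, (starRingEnd ℂ) (fourierL2 ħ u x) * fourierL2 ħ v x =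
      ∫ x, (fun y => (starRingEnd ℂ) ((𝓕 u : L2 d) y) * (𝓕 v : L2 d) y)
        ((2 * Real.pi * ħ)⁻¹ • x) := by
    refine integral_congr_ae ?_
    filter_upwards [fourierL2_ae hħ u, fourierL2_ae hħ v] with x hx hx2
    rw [hx, hx2]
  refine (h1.trans (Measure.integral_comp_smul volume
    (fun y => (starRingEnd ℂ) ((𝓕 u : L2 d) y) * (𝓕 v : L2 d) y) _)).trans ?_
  rw [Complex.real_smul, ← inv_pow, inv_inv, finrank_euclideanSpace_fin, abs_pow, abs_mul, abs_mul,
    abs_of_pos Real.pi_pos, abs_two]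

/-- The Schwartz functions are dense in `L²(ℝ^d)`. -/
theorem ext_of_schwartz {S T : L2 d →L[ℂ] L2 d}
    (h : ∀ u : 𝓢(E d, ℂ), S (u.toLp 2 volume) = T (u.toLp 2 volume)) : S = T := by
  refine ContinuousLinearMap.coeFn_injective ?_
  exact (SchwartzMap.denseRange_toLpCLM (F := ℂ) (E := E d) (μ := volume) (p := 2)
    ENNReal.ofNat_ne_top).equalizer S.continuous T.continuous (funext h)

theorem eq_of_inner_schwartz {a b : L2 d}
    (h : ∀ u : 𝓢(E d, ℂ), inner ℂ (u.toLp 2 volume) a = inner ℂ (u.toLp 2 volume) b) : a = b := by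
  refine ext_inner_left ℂ fun w => ?_
  have hd := SchwartzMap.denseRange_toLpCLM (F := ℂ) (E := E d) (μ := volume) (p := 2)
    ENNReal.ofNat_ne_top
  have h1 : Continuous fun w : L2 d => inner ℂ w a := by fun_prop
  have h2 : Continuous fun w : L2 d => inner ℂ w b := by fun_prop
  exact congrFun (hd.equalizer h1 h2 (funext h)) w

/-- Fubini, with a phase of modulus one and an integrable product `φ ⊗ ū`. It exhibits the
oscillatory integral with phase `⟨x, g(η)⟩` as the formal adjoint of `u ↦ (F u) ∘ g`. -/
theorem integral_conj_semiFourier_comp (ħ : ℝ) {g : E d → E d} (hg : Measurable g)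
    {u φ : E d → ℂ} (hu : Integrable u) (hφ : Integrable φ) :
    ∫ η, (starRingEnd ℂ) (semiFourier ħ u (g η)) * φ η =
      ∫ x, (starRingEnd ℂ) (u x) *
        ∫ η, Complex.exp ((Complex.I / ħ) * (inner ℝ x (g η) : ℝ)) * φ η := by
  have hexp : ∀ (s : ℝ), ‖Complex.exp ((Complex.I / ħ) * s)‖ = 1 := fun s => by
    rw [show (Complex.I / ħ) * s = ((s / ħ : ℝ) : ℂ) * Complex.I by push_cast; ring,
      Complex.norm_exp_ofReal_mul_I]
  have hconj : ∀ (s : ℝ), (starRingEnd ℂ) (Complex.exp (-(Complex.I / ħ) * s)) =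
      Complex.exp ((Complex.I / ħ) * s) := fun s => by
    rw [← Complex.exp_conj]
    congr 1
    simp [Complex.conj_ofReal, neg_div]
  have hint : Integrable (fun p : E d × E d =>
      Complex.exp ((Complex.I / ħ) * (inner ℝ p.2 (g p.1) : ℝ)) *
        (φ p.1 * (starRingEnd ℂ) (u p.2))) (volume.prod volume) := by
    have hu' : Integrable (fun x => (starRingEnd ℂ) (u x)) :=
      (Complex.conjLIE.toContinuousLinearEquiv.toContinuousLinearMap.integrable_comp hu)
    refine (hφ.mul_prod hu').bdd_mul (c := 1) ?_ (ae_of_all _ fun p => (hexp _).le)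
    refine Measurable.aestronglyMeasurable ?_
    have : Measurable fun p : E d × E d => g p.1 := hg.comp measurable_fst
    fun_prop
  have h1 : ∀ η, (starRingEnd ℂ) (semiFourier ħ u (g η)) * φ η =
      ∫ x, Complex.exp ((Complex.I / ħ) * (inner ℝ x (g η) : ℝ)) *
        (φ η * (starRingEnd ℂ) (u x)) := by
    intro η
    unfold semiFourier
    rw [← integral_conj, ← integral_mul_const]
    refine integral_congr_ae (ae_of_all _ fun x => ?_)
    simp only [map_mul, hconj]
    ring
  simp_rw [h1]
  rw [integral_integral_swap hint]
  refine integral_congr_ae (ae_of_all _ fun x => ?_)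
  simp only
  rw [← integral_const_mul]
  refine integral_congr_ae (ae_of_all _ fun η => ?_)
  simp only
  ring

/-- The preceding identity for `g = id`: conjugating the phase amounts to changing the sign of `ħ`.
This is why `fourierL2` is allowed negative parameters. -/
theorem adjoint_fourierL2 (ħ : ℝ) :
    ContinuousLinearMap.adjoint (fourierL2 ħ) = fourierL2 (d := d) (-ħ) := by
  by_cases hħ : ħ = 0
  · simp [hħ, fourierL2]
  symm
  refine ext_of_schwartz fun v => ?_
  refine eq_of_inner_schwartz fun u => ?_
  rw [ContinuousLinearMap.adjoint_inner_right, inner_eq_integral, inner_eq_integral]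
  have h1 := integral_conj_semiFourier_comp (d := d) ħ measurable_id u.integrable v.integrable
  have h2 : ∫ x, (starRingEnd ℂ) (u x) * semiFourier (-ħ) v x =
      ∫ η, (starRingEnd ℂ) (semiFourier ħ u (id η)) * v η := by
    rw [h1]
    refine integral_congr_ae (ae_of_all _ fun x => ?_)
    simp only [semiFourier, id]
    congr 1
    refine integral_congr_ae (ae_of_all _ fun y => ?_)
    simp only [real_inner_comm y x]
    congr 2
    push_cast
    rw [div_neg, neg_neg]
  refine Eq.trans ?_ (h2.trans ?_)
  · refine integral_congr_ae ?_
    filter_upwards [u.coeFn_toLp 2 volume, fourierL2_toLp_ae (neg_ne_zero.2 hħ) v] with x hx hx2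
    rw [hx, hx2]
  · refine integral_congr_ae ?_
    filter_upwards [v.coeFn_toLp 2 volume, fourierL2_toLp_ae hħ u] with x hx hx2
    rw [hx, hx2, id]

theorem adjoint_fourierL2_comp_self {ħ : ℝ} (hħ : ħ ≠ 0) :
    (ContinuousLinearMap.adjoint (fourierL2 ħ)).comp (fourierL2 ħ) =
      (((2 * Real.pi * |ħ|) ^ d : ℝ) : ℂ) • ContinuousLinearMap.id ℂ (L2 d) := by
  ext1 v
  refine ext_inner_left ℂ fun u => ?_
  rw [ContinuousLinearMap.comp_apply, ContinuousLinearMap.adjoint_inner_right, inner_fourierL2 hħ]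
  simp [inner_smul_right]

/-- Obtained from the identity for `F^* F` at `-ħ`, so surjectivity of `F` need not be discussed. -/
theorem fourierL2_comp_adjoint {ħ : ℝ} (hħ : ħ ≠ 0) :
    (fourierL2 ħ).comp (ContinuousLinearMap.adjoint (fourierL2 ħ)) =
      (((2 * Real.pi * |ħ|) ^ d : ℝ) : ℂ) • ContinuousLinearMap.id ℂ (L2 d) := by
  have := adjoint_fourierL2_comp_self (d := d) (neg_ne_zero.2 hħ)
  rwa [adjoint_fourierL2, neg_neg, abs_neg, ← adjoint_fourierL2] at this

/-- Real smooth compactly supported functions are Schwartz, and they separate locally integrable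
functions; `F` need not be known to lie in `L²`. -/
theorem ae_eq_of_inner_schwartz {w : L2 d} {F : E d → ℂ} (hF : LocallyIntegrable F)
    (h : ∀ u : 𝓢(E d, ℂ), inner ℂ (u.toLp 2 volume) w = ∫ x, (starRingEnd ℂ) (u x) * F x) :
    w =ᵐ[volume] F := by
  refine ae_eq_of_integral_contDiff_smul_eq ((Lp.memLp w).locallyIntegrable (by norm_num)) hF
    fun f hf hfc => ?_
  have hfc' : HasCompactSupport (fun x => (f x : ℂ)) := hfc.comp_left (g := Complex.ofReal) rfl
  have hf' : ContDiff ℝ ∞ (fun x => (f x : ℂ)) := Complex.ofRealCLM.contDiff.comp hf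
  obtain ⟨u, hux⟩ : ∃ u : 𝓢(E d, ℂ), ∀ x, u x = f x := ⟨hfc'.toSchwartzMap hf', fun x => rfl⟩
  have h2 := h u
  rw [inner_eq_integral] at h2
  refine Eq.trans ?_ (h2.trans ?_)
  · refine integral_congr_ae ?_
    filter_upwards [u.coeFn_toLp 2 volume] with x hx
    rw [hx, hux, Complex.conj_ofReal, Complex.real_smul]
  · refine integral_congr_ae (ae_of_all _ fun x => ?_)
    simp only [hux, Complex.conj_ofReal, Complex.real_smul]

theorem inner_adjoint_compOp_fourierL2 {ħ : ℝ} (hħ : ħ ≠ 0) {k : E d → ℝ} {g : E d → E d}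
    {C : ℝ≥0} (h : IsCompBounded k g C) (φ : L2 d) (hφ : Integrable (fun η => (k η : ℂ) * φ η))
    (u : 𝓢(E d, ℂ)) :
    inner ℂ (u.toLp 2 volume) (ContinuousLinearMap.adjoint ((compOp h).comp (fourierL2 ħ)) φ) =
      ∫ x, (starRingEnd ℂ) (u x) *
        ∫ η, Complex.exp ((Complex.I / ħ) * (inner ℝ x (g η) : ℝ)) * (k η * φ η) := by
  rw [← integral_conj_semiFourier_comp ħ h.measurable_map u.integrable hφ,
    ContinuousLinearMap.adjoint_inner_right, inner_eq_integral, ContinuousLinearMap.comp_apply]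
  refine integral_congr_ae ?_
  filter_upwards [compOp_ae h (fourierL2 ħ (u.toLp 2 volume)),
    h.ae_comp (fourierL2_toLp_ae hħ u)] with η hη hη2
  rw [hη]
  by_cases hk : k η = 0
  · simp [hk]
  · rw [hη2 hk, map_mul, Complex.conj_ofReal]
    ring

/-- The adjoint, so far known only weakly, is an honest oscillatory integral: the integral is
continuous in `x` by dominated convergence, hence locally integrable. This identifies `V` as a
multiple of `(C F)^*`. -/
theorem adjoint_compOp_fourierL2_ae {ħ : ℝ} (hħ : ħ ≠ 0) {k : E d → ℝ} {g : E d → E d} {C : ℝ≥0}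
    (h : IsCompBounded k g C) (φ : L2 d) (hφ : Integrable (fun η => (k η : ℂ) * φ η)) :
    ContinuousLinearMap.adjoint ((compOp h).comp (fourierL2 ħ)) φ =ᵐ[volume]
      fun x => ∫ η, Complex.exp ((Complex.I / ħ) * (inner ℝ x (g η) : ℝ)) * (k η * φ η) := by
  refine ae_eq_of_inner_schwartz (Continuous.locallyIntegrable ?_)
    (inner_adjoint_compOp_fourierL2 hħ h φ hφ)
  refine continuous_of_dominated (bound := fun η => ‖(k η : ℂ) * φ η‖) (fun x => ?_)
    (fun x => ae_of_all _ fun η => ?_) hφ.norm (ae_of_all _ fun η => by fun_prop)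
  · refine AEStronglyMeasurable.mul (Measurable.aestronglyMeasurable ?_) hφ.1
    have := h.measurable_map
    fun_prop
  · rw [norm_mul, show (Complex.I / ħ) * (inner ℝ x (g η) : ℝ) =
      ((inner ℝ x (g η) / ħ : ℝ) : ℂ) * Complex.I by push_cast; ring,
      Complex.norm_exp_ofReal_mul_I, one_mul]

/-! ### The kernel of the Weyl quantization -/

/-- The integral kernel of the semiclassical Weyl quantization of `b`. -/
def weylKernel (ħ : ℝ) (b : E d × E d → ℂ) (x y : E d) : ℂ :=
  (((2 * Real.pi * ħ) ^ d : ℝ) : ℂ)⁻¹ *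
    ∫ θ, Complex.exp ((Complex.I / ħ) * (inner ℝ (x - y) θ : ℝ)) * b ((1 / 2 : ℝ) • (x + y), θ)

theorem norm_exp_I_div (ħ s : ℝ) : ‖Complex.exp ((Complex.I / ħ) * s)‖ = 1 := by
  rw [show (Complex.I / ħ) * s = ((s / ħ : ℝ) : ℂ) * Complex.I by push_cast; ring,
    Complex.norm_exp_ofReal_mul_I]

theorem norm_exp_neg_I_div (ħ s : ℝ) : ‖Complex.exp (-(Complex.I / ħ) * s)‖ = 1 := by
  rw [show -(Complex.I / ħ) * s = ((-s / ħ : ℝ) : ℂ) * Complex.I by push_cast; ring,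
    Complex.norm_exp_ofReal_mul_I]

/-- A compactly supported function on phase space vanishes at large distances. -/
theorem exists_radius {X : Type*} [Zero X] {b : E d × E d → X} (hb : HasCompactSupport b) :
    ∃ R : ℝ, 0 ≤ R ∧ ∀ z θ, b (z, θ) ≠ 0 → ‖z‖ ≤ R ∧ ‖θ‖ ≤ R := by
  obtain ⟨R, hR⟩ := hb.isBounded.exists_norm_le
  refine ⟨max R 0, le_max_right _ _, fun z θ h => ?_⟩
  have h1 := hR (z, θ) (subset_tsupport _ h)
  exact ⟨(norm_fst_le (z, θ)).trans (h1.trans (le_max_left _ _)),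
    (norm_snd_le (z, θ)).trans (h1.trans (le_max_left _ _))⟩

/-- A slice is a translate of `b` composed with the inclusion of the second factor, a linear map of
norm at most one. -/
theorem norm_iteratedFDeriv_slice_le {b : E d × E d → ℂ} (hb : ContDiff ℝ ∞ b) (j : ℕ)
    (z θ : E d) :
    ‖iteratedFDeriv ℝ j (fun θ => b (z, θ)) θ‖ ≤ ‖iteratedFDeriv ℝ j b (z, θ)‖ := by
  have h1 : (fun θ => b (z, θ)) =
      (fun p => b ((z, 0) + p)) ∘ (ContinuousLinearMap.inr ℝ (E d) (E d)) := by
    ext θ; simp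
  have h2 : ContDiff ℝ ∞ (fun p : E d × E d => b ((z, 0) + p)) := hb.comp (by fun_prop)
  rw [h1, ContinuousLinearMap.iteratedFDeriv_comp_right _ h2 θ (by exact_mod_cast le_top),
    iteratedFDeriv_comp_add_left]
  refine (ContinuousMultilinearMap.norm_compContinuousLinearMap_le _ _).trans ?_
  have h3 : ‖ContinuousLinearMap.inr ℝ (E d) (E d)‖ ≤ 1 :=
    ContinuousLinearMap.opNorm_le_bound _ zero_le_one fun v => by simp
  simp only [Finset.prod_const, Finset.card_univ, Fintype.card_fin]
  refine (mul_le_of_le_one_right (norm_nonneg _) (pow_le_one₀ (norm_nonneg _) h3)).trans_eq ?_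
  simp

theorem exists_integral_iteratedFDeriv_slice_le {b : E d × E d → ℂ} (hb : ContDiff ℝ ∞ b)
    (hbc : HasCompactSupport b) (j : ℕ) :
    ∃ C : ℝ, 0 ≤ C ∧ ∀ z : E d, Integrable (fun θ => ‖iteratedFDeriv ℝ j (fun θ => b (z, θ)) θ‖) ∧
      ∫ θ, ‖iteratedFDeriv ℝ j (fun θ => b (z, θ)) θ‖ ≤ C := by
  have hcont : Continuous (iteratedFDeriv ℝ j b) :=
    hb.continuous_iteratedFDeriv (by exact_mod_cast le_top)
  have hcomp : HasCompactSupport (iteratedFDeriv ℝ j b) := hbc.iteratedFDeriv j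
  obtain ⟨R, hR0, hR⟩ := exists_radius hcomp
  obtain ⟨M, hM⟩ := hcont.bounded_above_of_compact_support hcomp
  have hM0 : 0 ≤ M := (norm_nonneg _).trans (hM 0)
  have hfin : volume (Metric.closedBall (0 : E d) R) < ⊤ := measure_closedBall_lt_top
  have hbd : Integrable ((Metric.closedBall (0 : E d) R).indicator fun _ => M) :=
    (integrable_indicator_iff Metric.isClosed_closedBall.measurableSet).2
      (integrableOn_const hfin.ne)
  have hle : ∀ z θ : E d, ‖iteratedFDeriv ℝ j (fun θ => b (z, θ)) θ‖ ≤
      (Metric.closedBall (0 : E d) R).indicator (fun _ => M) θ := by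
    intro z θ
    refine (norm_iteratedFDeriv_slice_le hb j z θ).trans ?_
    by_cases h : iteratedFDeriv ℝ j b (z, θ) = 0
    · rw [h, norm_zero]
      exact Set.indicator_nonneg (fun _ _ => hM0) _
    · rw [Set.indicator_of_mem (by simpa using (hR z θ h).2)]
      exact hM _
  refine ⟨∫ θ, (Metric.closedBall (0 : E d) R).indicator (fun _ => M) θ,
    integral_nonneg fun θ => Set.indicator_nonneg (fun _ _ => hM0) _, fun z => ?_⟩
  have hslice : ContDiff ℝ ∞ (fun θ => b (z, θ)) := hb.comp (by fun_prop)
  have hint : Integrable (fun θ => ‖iteratedFDeriv ℝ j (fun θ => b (z, θ)) θ‖) := by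
    refine hbd.mono' ?_ (ae_of_all _ fun θ => ?_)
    · exact (hslice.continuous_iteratedFDeriv (by exact_mod_cast le_top)).norm.aestronglyMeasurable
    · rw [norm_norm]; exact hle z θ
  exact ⟨hint, integral_mono hint hbd (hle z)⟩

theorem weylKernel_eq_fourier {ħ : ℝ} (b : E d × E d → ℂ) (x y : E d) :
    weylKernel ħ b x y = (((2 * Real.pi * ħ) ^ d : ℝ) : ℂ)⁻¹ *
      𝓕 (fun θ => b ((1 / 2 : ℝ) • (x + y), θ)) ((2 * Real.pi * ħ)⁻¹ • (y - x)) := by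
  rw [← semiFourier_eq, weylKernel, semiFourier]
  congr 1
  refine integral_congr_ae (ae_of_all _ fun θ => ?_)
  simp only
  congr 2
  rw [real_inner_comm, ← neg_sub y x, inner_neg_right]
  push_cast
  ring

/-- Rapid decay of the Weyl kernel away from the diagonal. -/
theorem exists_pow_mul_norm_weylKernel_le {b : E d × E d → ℂ} (hb : ContDiff ℝ ∞ b)
    (hbc : HasCompactSupport b) (n : ℕ) :
    ∃ C : ℝ, 0 ≤ C ∧ ∀ ħ : ℝ, 0 < ħ → ∀ x y,
      ‖x - y‖ ^ n * ‖weylKernel ħ b x y‖ ≤ C * ħ ^ n * (ħ ^ d)⁻¹ := by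
  choose C hC0 hC using exists_integral_iteratedFDeriv_slice_le hb hbc
  refine ⟨(2 * Real.pi) ^ n * (2 ^ n * ∑ j ∈ Finset.range (n + 1), C j) * ((2 * Real.pi) ^ d)⁻¹,
    ?_, fun ħ hħ x y => ?_⟩
  · have := Finset.sum_nonneg (s := Finset.range (n + 1)) fun j _ => hC0 j
    positivity
  set z : E d := (1 / 2 : ℝ) • (x + y)
  have hslice : ContDiff ℝ ∞ (fun θ => b (z, θ)) := hb.comp (by fun_prop)
  -- No derivative of the transform and no polynomial weight on the symbol: `n` derivatives in `θ`
  -- are traded for `n` powers of the frequency.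
  have h1 := Real.pow_mul_norm_iteratedFDeriv_fourier_le (f := fun θ => b (z, θ)) (K := 0) (N := n)
    (k := 0) (n := n) (hslice.of_le (by exact_mod_cast le_top)) (fun k j hk _ => by
      have : k = 0 := by simpa using hk
      subst this
      simpa using (hC j z).1) le_rfl le_rfl ((2 * Real.pi * ħ)⁻¹ • (y - x))
  have h2 : ‖(2 * Real.pi * ħ)⁻¹ • (y - x)‖ ^ n * ‖𝓕 (fun θ => b (z, θ)) ((2 * Real.pi * ħ)⁻¹ • (y - x))‖
      ≤ 2 ^ n * ∑ j ∈ Finset.range (n + 1), C j := by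
    rw [norm_iteratedFDeriv_zero] at h1
    refine h1.trans ?_
    simp only [pow_zero, Finset.range_one, one_mul, zero_add, CharP.cast_eq_zero, mul_zero]
    gcongr
    rw [Finset.sum_product]
    simp only [Finset.sum_singleton, pow_zero, one_mul]
    exact Finset.sum_le_sum fun j _ => (hC j z).2
  have hp : 0 < 2 * Real.pi * ħ := by positivity
  rw [norm_smul, norm_inv, Real.norm_of_nonneg hp.le, mul_pow, inv_pow, ← norm_sub_rev x y] at h2
  rw [weylKernel_eq_fourier, norm_mul, norm_inv, Complex.norm_real, Real.norm_of_nonneg (by positivity)]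
  -- The frequency is `(y - x)/(2πħ)`, so each power of it yields a factor `ħ`.
  have h3 : ‖x - y‖ ^ n * ‖𝓕 (fun θ => b (z, θ)) ((2 * Real.pi * ħ)⁻¹ • (y - x))‖ ≤
      (2 * Real.pi * ħ) ^ n * (2 ^ n * ∑ j ∈ Finset.range (n + 1), C j) := by
    rw [mul_assoc, inv_mul_le_iff₀ (by positivity)] at h2
    exact h2
  calc _ = (‖x - y‖ ^ n * ‖𝓕 (fun θ => b (z, θ)) ((2 * Real.pi * ħ)⁻¹ • (y - x))‖) *
        ((2 * Real.pi * ħ) ^ d)⁻¹ := by ring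
    _ ≤ ((2 * Real.pi * ħ) ^ n * (2 ^ n * ∑ j ∈ Finset.range (n + 1), C j)) *
        ((2 * Real.pi * ħ) ^ d)⁻¹ := by gcongr
    _ = _ := by rw [mul_pow _ ħ n, mul_pow _ ħ d, mul_inv]; ring

theorem weylKernel_eq_zero {ħ : ℝ} {b : E d × E d → ℂ} {x y : E d}
    (h : ∀ θ, b ((1 / 2 : ℝ) • (x + y), θ) = 0) : weylKernel ħ b x y = 0 := by
  unfold weylKernel
  simp only [h, mul_zero, integral_zero]

/-- The weight `(1 + |x|)^{-(d+1)}`. -/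
def decay (x : E d) : ℝ := ((1 + ‖x‖) ^ (d + 1))⁻¹

theorem decay_nonneg (x : E d) : 0 ≤ decay x := by unfold decay; positivity

theorem continuous_decay : Continuous (decay : E d → ℝ) := by
  unfold decay
  exact Continuous.inv₀ (by fun_prop) fun x => by positivity

theorem integrable_decay : Integrable (decay : E d → ℝ) := by
  have := integrable_one_add_norm (E := E d) (μ := volume) (r := d + 1) (by simp)
  refine this.congr (ae_of_all _ fun x => ?_)
  simp only [decay]
  rw [Real.rpow_neg (by positivity)]
  norm_cast

theorem decay_le_one (x : E d) : decay x ≤ 1 :=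
  inv_le_one_of_one_le₀ (one_le_pow₀ (by simp))

/-- Since `0 ≤ decay ≤ 1`, its square is dominated by `decay`, integrable because the exponent `d +
1` exceeds the dimension. -/
theorem memLp_decay : MemLp (decay : E d → ℝ) 2 volume := by
  rw [memLp_two_iff_integrable_sq continuous_decay.aestronglyMeasurable]
  refine integrable_decay.mono' (by have := continuous_decay (d := d); fun_prop)
    (ae_of_all _ fun x => ?_)
  rw [Real.norm_of_nonneg (by positivity), sq]
  exact mul_le_of_le_one_left (decay_nonneg x) (decay_le_one x)

/-- The Weyl kernel is dominated by a product, with a gain `ħ ^ M` away from the diagonal. -/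
theorem exists_norm_weylKernel_le {b : E d × E d → ℂ} (hb : ContDiff ℝ ∞ b)
    (hbc : HasCompactSupport b) (M : ℕ) {r : ℝ} (hr : 0 < r) :
    ∃ A : ℝ, 0 ≤ A ∧ ∀ ħ : ℝ, 0 < ħ → ∀ x y, r ^ M ≤ ‖x - y‖ ^ M →
      ‖weylKernel ħ b x y‖ ≤
        A * (1 + ħ ^ (2 * (d + 1))) * ħ ^ M * (ħ ^ d)⁻¹ * (decay x * decay y) := by
  -- `M` powers of `‖x - y‖` give the gain `ħ ^ M`; the further `2 (d + 1)` powers pay for the two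
  -- decaying weights.
  obtain ⟨C₁, hC₁, h₁⟩ := exists_pow_mul_norm_weylKernel_le hb hbc M
  obtain ⟨C₂, hC₂, h₂⟩ := exists_pow_mul_norm_weylKernel_le hb hbc (M + 2 * (d + 1))
  obtain ⟨R, hR0, hR⟩ := exists_radius hbc
  set p := 2 * (d + 1)
  refine ⟨(1 + R) ^ p * 2 ^ (p - 1) * (r ^ M)⁻¹ * (C₁ + C₂), by positivity,
    fun ħ hħ x y hxy => ?_⟩
  by_cases hz : ∀ θ, b ((1 / 2 : ℝ) • (x + y), θ) = 0
  · rw [weylKernel_eq_zero hz, norm_zero]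
    have := decay_nonneg x
    have := decay_nonneg y
    positivity
  push Not at hz
  obtain ⟨θ, hθ⟩ := hz
  have hzR := (hR _ _ hθ).1
  set z : E d := (1 / 2 : ℝ) • (x + y)
  set w : E d := x - y
  set K := ‖weylKernel ħ b x y‖
  have hK : 0 ≤ K := norm_nonneg _
  have hhalf : ‖(1 / 2 : ℝ) • w‖ = 1 / 2 * ‖w‖ := by
    rw [norm_smul (1 / 2 : ℝ) w, Real.norm_of_nonneg (by norm_num)]
  -- The midpoint `z` stays in a ball of radius `R`, and `x`, `y` are `z ± w/2`; both are thus
  -- controlled by the separation `w` alone.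
  have hbd : ∀ s : E d, ‖s‖ ≤ ‖z‖ + 1 / 2 * ‖w‖ → 1 + ‖s‖ ≤ (1 + R) * (1 + ‖w‖) := fun s hs => by
    nlinarith [norm_nonneg w, mul_nonneg hR0 (norm_nonneg w)]
  have hx : 1 + ‖x‖ ≤ (1 + R) * (1 + ‖w‖) := by
    refine hbd x ?_
    rw [← hhalf, show x = z + (1 / 2 : ℝ) • w by simp only [z, w]; module]
    exact norm_add_le _ _
  have hy : 1 + ‖y‖ ≤ (1 + R) * (1 + ‖w‖) := by
    refine hbd y ?_
    rw [← hhalf, show y = z - (1 / 2 : ℝ) • w by simp only [z, w]; module]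
    exact norm_sub_le _ _
  have h4 : (1 + ‖x‖) ^ (d + 1) * (1 + ‖y‖) ^ (d + 1) ≤ (1 + R) ^ p * (1 + ‖w‖) ^ p := by
    calc _ ≤ ((1 + R) * (1 + ‖w‖)) ^ (d + 1) * ((1 + R) * (1 + ‖w‖)) ^ (d + 1) := by gcongr
      _ = _ := by
        rw [mul_pow, show p = (d + 1) + (d + 1) from two_mul _, pow_add (1 + R) (d + 1),
          pow_add (1 + ‖w‖) (d + 1), mul_mul_mul_comm]
  have h5 : (1 + ‖w‖) ^ p ≤ 2 ^ (p - 1) * (1 + ‖w‖ ^ p) := by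
    simpa using add_pow_le zero_le_one (norm_nonneg w) p
  have h6 : r ^ M * ((1 + ‖w‖ ^ p) * K) ≤ (C₁ + C₂) * (1 + ħ ^ p) * ħ ^ M * (ħ ^ d)⁻¹ := by
    calc r ^ M * ((1 + ‖w‖ ^ p) * K) ≤ ‖w‖ ^ M * ((1 + ‖w‖ ^ p) * K) := by gcongr
      _ = ‖w‖ ^ M * K + ‖w‖ ^ (M + p) * K := by ring
      _ ≤ C₁ * ħ ^ M * (ħ ^ d)⁻¹ + C₂ * ħ ^ (M + p) * (ħ ^ d)⁻¹ := add_le_add (h₁ ħ hħ x y) (h₂ ħ hħ x y)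
      _ = (C₁ * 1 + C₂ * ħ ^ p) * ħ ^ M * (ħ ^ d)⁻¹ := by ring
      _ ≤ _ := by
        gcongr
        nlinarith [pow_pos hħ p, mul_nonneg hC₁ (pow_pos hħ p).le]
  have h7 : (1 + ‖w‖ ^ p) * K ≤ (r ^ M)⁻¹ * ((C₁ + C₂) * (1 + ħ ^ p) * ħ ^ M * (ħ ^ d)⁻¹) := by
    rw [le_inv_mul_iff₀ (by positivity)]; exact h6
  unfold decay
  rw [← mul_inv, ← div_eq_mul_inv, le_div_iff₀ (by positivity)]
  calc K * ((1 + ‖x‖) ^ (d + 1) * (1 + ‖y‖) ^ (d + 1))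
      ≤ K * ((1 + R) ^ p * (2 ^ (p - 1) * (1 + ‖w‖ ^ p))) :=
        mul_le_mul_of_nonneg_left (h4.trans (by gcongr)) hK
    _ = (1 + R) ^ p * 2 ^ (p - 1) * ((1 + ‖w‖ ^ p) * K) := by ring
    _ ≤ (1 + R) ^ p * 2 ^ (p - 1) * ((r ^ M)⁻¹ * ((C₁ + C₂) * (1 + ħ ^ p) * ħ ^ M * (ħ ^ d)⁻¹)) := by
        gcongr
    _ = _ := by ring

theorem continuous_weylKernel {ħ : ℝ} {b : E d × E d → ℂ} (hb : Continuous b)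
    (hbc : HasCompactSupport b) : Continuous (Function.uncurry (weylKernel ħ b)) := by
  obtain ⟨R, hR0, hR⟩ := exists_radius hbc
  obtain ⟨M, hM⟩ := hb.bounded_above_of_compact_support hbc
  have hM0 : 0 ≤ M := (norm_nonneg _).trans (hM 0)
  refine continuous_const.mul (continuous_of_dominated
    (bound := (Metric.closedBall (0 : E d) R).indicator fun _ => M) (fun p => ?_) (fun p => ?_) ?_
    (ae_of_all _ fun θ => ?_))
  · exact Continuous.aestronglyMeasurable (by fun_prop)
  · refine ae_of_all _ fun θ => ?_
    rw [norm_mul, norm_exp_I_div, one_mul]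
    by_cases h : b ((1 / 2 : ℝ) • (p.1 + p.2), θ) = 0
    · rw [h, norm_zero]
      exact Set.indicator_nonneg (fun _ _ => hM0) _
    · rw [Set.indicator_of_mem (by simpa using (hR _ θ h).2)]
      exact hM _
  · exact (integrable_indicator_iff Metric.isClosed_closedBall.measurableSet).2
      (integrableOn_const measure_closedBall_lt_top.ne)
  · fun_prop

theorem exists_isDominatedKernel {b : E d × E d → ℂ} (hb : ContDiff ℝ ∞ b)
    (hbc : HasCompactSupport b) : ∃ A : ℝ, 0 ≤ A ∧ ∀ ħ : ℝ, 0 < ħ →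
      IsDominatedKernel (weylKernel ħ b) decay (A * (1 + ħ ^ (2 * (d + 1))) * (ħ ^ d)⁻¹) := by
  -- For `M = 0` the separation condition reads `1 ≤ 1`, so the bound holds also on the diagonal.
  obtain ⟨A, hA, h⟩ := exists_norm_weylKernel_le hb hbc 0 one_pos
  refine ⟨A, hA, fun ħ hħ => ⟨continuous_weylKernel hb.continuous hbc, memLp_decay, decay_nonneg,
    by positivity, fun x y => ?_⟩⟩
  simpa using h ħ hħ x y (by simp)

/-! ### The Weyl quantization on `L²` -/

open Classical in
/-- The Weyl quantization of `b` as an operator on `L²(ℝ^d)` (zero if the kernel of the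
quantization is not dominated by a multiple of the product of decaying weights). -/
def weylL2 (ħ : ℝ) (b : E d × E d → ℂ) : L2 d →L[ℂ] L2 d :=
  if h : ∃ A, IsDominatedKernel (weylKernel ħ b) decay A then kernelOp h.choose_spec else 0

/-- The chosen constant affects only the proof of boundedness, so any admissible constant gives the
same operator. -/
theorem weylL2_eq {ħ : ℝ} {b : E d × E d → ℂ} {A : ℝ}
    (h : IsDominatedKernel (weylKernel ħ b) decay A) : weylL2 ħ b = kernelOp h := by
  have h' : ∃ A, IsDominatedKernel (weylKernel ħ b) decay A := ⟨A, h⟩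
  rw [weylL2, dif_pos h']
  ext1 u
  refine Lp.ext ?_
  filter_upwards [kernelOp_ae h'.choose_spec u, kernelOp_ae h u] with x h1 h2
  rw [h1, h2]

theorem IsDominatedKernel.weylL2_ae {ħ : ℝ} {b : E d × E d → ℂ} {A : ℝ}
    (h : IsDominatedKernel (weylKernel ħ b) decay A) (u : L2 d) :
    weylL2 ħ b u =ᵐ[volume] fun x => ∫ y, weylKernel ħ b x y * u y := by
  rw [weylL2_eq h]; exact kernelOp_ae h u

theorem IsDominatedKernel.weylL2_toLp_ae {ħ : ℝ} {b : E d × E d → ℂ} {A : ℝ}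
    (h : IsDominatedKernel (weylKernel ħ b) decay A) (u : 𝓢(E d, ℂ)) :
    weylL2 ħ b (u.toLp 2 volume) =ᵐ[volume] fun x => ∫ y, weylKernel ħ b x y * u y := by
  filter_upwards [h.weylL2_ae (u.toLp 2 volume)] with x hx
  rw [hx]
  refine integral_congr_ae ?_
  filter_upwards [u.coeFn_toLp 2 volume] with y hy
  rw [hy]

theorem isGivenBy_weylL2 {b : E d × E d → ℂ} (hb : ContDiff ℝ ∞ b) (hbc : HasCompactSupport b)
    {ħ : ℝ} (hħ : 0 < ħ) : IsGivenBy (weylL2 ħ b) (opWeyl ħ b) := by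
  intro u
  obtain ⟨A, -, hA⟩ := exists_isDominatedKernel hb hbc
  filter_upwards [(hA ħ hħ).weylL2_toLp_ae u] with x hx
  rw [hx, opWeyl]
  obtain ⟨R, -, hR⟩ := exists_radius hbc
  have hbcont := hb.continuous
  have hint : Integrable (fun p : E d × E d =>
      Complex.exp ((Complex.I / ħ) * (inner ℝ (x - p.2) p.1 : ℝ)) *
      (b ((1 / 2 : ℝ) • (x + p.2), p.1) * u p.2)) (volume.prod volume) := by
    have hu : Continuous u := u.continuous
    refine Continuous.integrable_of_hasCompactSupport (by fun_prop) ?_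
    -- For fixed `x` the symbol confines `θ` and the midpoint to radius `R`, hence `‖y‖ ≤ 2R + ‖x‖`.
    refine HasCompactSupport.of_support_subset_isCompact
      ((isCompact_closedBall (0 : E d) R).prod (isCompact_closedBall (0 : E d) (2 * R + ‖x‖)))
      fun p hp => ?_
    have hb0 : b ((1 / 2 : ℝ) • (x + p.2), p.1) ≠ 0 := by
      intro h0
      simp only [Function.mem_support, h0, zero_mul, mul_zero, ne_eq, not_true_eq_false] at hp
    obtain ⟨h1, h2⟩ := hR _ _ hb0
    refine ⟨by simpa using h2, ?_⟩
    rw [norm_smul, Real.norm_of_nonneg (by norm_num)] at h1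
    have h3 : ‖p.2‖ ≤ ‖x + p.2‖ + ‖x‖ := by
      simpa using norm_sub_le (x + p.2) x
    simp only [Metric.mem_closedBall, dist_zero_right]
    linarith
  rw [integral_integral_swap hint, ← integral_const_mul]
  refine integral_congr_ae (ae_of_all _ fun y => ?_)
  simp only [weylKernel]
  rw [mul_assoc, ← integral_mul_const]
  congr 1
  refine integral_congr_ae (ae_of_all _ fun θ => ?_)
  simp only
  ring

/-! ### Conjugation of Weyl operators by the Fourier transform -/

/-- The action of the Fourier transform on symbols. -/
def rotate (b : E d × E d → ℂ) (p : E d × E d) : ℂ := b (-p.2, p.1)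

theorem contDiff_rotate {b : E d × E d → ℂ} (hb : ContDiff ℝ ∞ b) : ContDiff ℝ ∞ (rotate b) :=
  hb.comp (by fun_prop)

theorem hasCompactSupport_rotate {b : E d × E d → ℂ} (hb : HasCompactSupport b) :
    HasCompactSupport (rotate b) := by
  let e : E d × E d ≃ₜ E d × E d :=
    { toFun := fun p => (-p.2, p.1), invFun := fun p => (p.2, -p.1)
      left_inv := fun p => by simp, right_inv := fun p => by simp
      continuous_toFun := by fun_prop, continuous_invFun := by fun_prop }
  exact hb.comp_homeomorph e

/-- The integral of the symbol against the phase which appears in the conjugation of a Weyl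
operator by the Fourier transform. -/
def conjPhase (ħ : ℝ) (b : E d × E d → ℂ) (ξ y z θ : E d) : ℂ :=
  Complex.exp ((Complex.I / ħ) * ((2 * inner ℝ z θ - 2 * inner ℝ y θ - 2 * inner ℝ z ξ
    + inner ℝ y ξ : ℝ) : ℂ)) * b (z, θ)

theorem integral_comp_two_smul_sub (f : E d → ℂ) (y : E d) :
    ∫ x, f x = 2 ^ d * ∫ z, f ((2 : ℝ) • z - y) := by
  have h1 := Measure.integral_comp_smul (volume : Measure (E d)) (fun z => f (z - y)) (2 : ℝ)
  rw [h1, integral_sub_right_eq_self (fun z => f z) y, finrank_euclideanSpace_fin,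
    Complex.real_smul, abs_of_pos (by positivity)]
  push_cast
  rw [mul_inv_cancel_left₀ (pow_ne_zero _ two_ne_zero)]

/-- Substituting `x = 2z - y` makes the midpoint `z` the variable, with Jacobian `2 ^ d`. The left
side is the kernel of `F Op(b)`. -/
theorem integral_exp_mul_weylKernel (ħ : ℝ) (b : E d × E d → ℂ) (ξ y : E d) :
    ∫ x, Complex.exp (-(Complex.I / ħ) * (inner ℝ x ξ : ℝ)) * weylKernel ħ b x y =
      2 ^ d * ((((2 * Real.pi * ħ) ^ d : ℝ) : ℂ)⁻¹ * ∫ z, ∫ θ, conjPhase ħ b ξ y z θ) := by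
  rw [integral_comp_two_smul_sub _ y, ← integral_const_mul (((2 * Real.pi * ħ) ^ d : ℝ) : ℂ)⁻¹]
  congr 1
  refine integral_congr_ae (ae_of_all _ fun z => ?_)
  simp only [weylKernel]
  rw [mul_left_comm, ← integral_const_mul]
  congr 1
  refine integral_congr_ae (ae_of_all _ fun θ => ?_)
  simp only [conjPhase]
  rw [← mul_assoc, ← Complex.exp_add]
  congr 2
  · simp only [inner_sub_left, inner_smul_left]
    simp only [RCLike.conj_to_real]
    push_cast
    ring
  · congr 2
    rw [sub_add_cancel, smul_smul]; norm_num

/-- Here the midpoint of `ξ` and `η` becomes the variable `θ`. The same phase appears as for `F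
Op(b)`, with the integrations in the opposite order. -/
theorem integral_weylKernel_rotate_mul_exp (ħ : ℝ) (b : E d × E d → ℂ) (ξ y : E d) :
    ∫ η, weylKernel ħ (rotate b) ξ η * Complex.exp (-(Complex.I / ħ) * (inner ℝ y η : ℝ)) =
      2 ^ d * ((((2 * Real.pi * ħ) ^ d : ℝ) : ℂ)⁻¹ * ∫ θ, ∫ z, conjPhase ħ b ξ y z θ) := by
  rw [integral_comp_two_smul_sub _ ξ, ← integral_const_mul (((2 * Real.pi * ħ) ^ d : ℝ) : ℂ)⁻¹]
  congr 1
  refine integral_congr_ae (ae_of_all _ fun θ => ?_)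
  simp only [weylKernel]
  -- The reflection `z ↦ -z` undoes the sign in `rotate`.
  rw [mul_assoc, ← integral_mul_const, ← integral_neg_eq_self]
  congr 1
  refine integral_congr_ae (ae_of_all _ fun z => ?_)
  simp only [conjPhase, rotate, neg_neg]
  rw [mul_right_comm, ← Complex.exp_add]
  congr 2
  · simp only [inner_sub_left, inner_sub_right, inner_smul_left, inner_smul_right, inner_neg_right]
    simp only [RCLike.conj_to_real, real_inner_comm z]
    push_cast
    ring
  · congr 2
    rw [add_sub_cancel, smul_smul]; norm_num

theorem integral_conjPhase_swap (ħ : ℝ) {b : E d × E d → ℂ} (hb : Continuous b)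
    (hbc : HasCompactSupport b) (ξ y : E d) :
    ∫ z, ∫ θ, conjPhase ħ b ξ y z θ = ∫ θ, ∫ z, conjPhase ħ b ξ y z θ := by
  refine integral_integral_swap ?_
  refine Continuous.integrable_of_hasCompactSupport ?_ ?_
  · unfold conjPhase Function.uncurry
    fun_prop
  · refine HasCompactSupport.mul_left ?_
    exact hbc

/-- The adjoint formula with weight `1`, `g = id` and parameter `-ħ`. It is needed because the
output of a Weyl operator is known here only to be in `L¹ ∩ L²`, not Schwartz. -/
theorem fourierL2_ae_of_integrable {ħ : ℝ} (hħ : ħ ≠ 0) (φ : L2 d) (hφ : Integrable φ) :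
    fourierL2 ħ φ =ᵐ[volume] semiFourier ħ φ := by
  have hk : IsCompBounded (fun _ : E d => (1 : ℝ)) id 1 :=
    isCompBounded_id measurable_const (by simp)
  have h1 := adjoint_compOp_fourierL2_ae (neg_ne_zero.2 hħ) hk φ (by simpa using hφ)
  have h2 : compOp hk = ContinuousLinearMap.id ℂ (L2 d) := by
    ext1 u
    refine Lp.ext ?_
    filter_upwards [compOp_ae hk u] with x hx
    simp [hx]
  rw [h2, ContinuousLinearMap.id_comp, adjoint_fourierL2, neg_neg] at h1
  filter_upwards [h1] with x hx
  rw [hx, semiFourier]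
  refine integral_congr_ae (ae_of_all _ fun η => ?_)
  simp only [id, real_inner_comm x, Complex.ofReal_one, one_mul]
  congr 2
  push_cast
  rw [div_neg]

theorem IsDominatedKernel.integrable_mul_schwartz {ħ : ℝ} {b : E d × E d → ℂ} {A : ℝ}
    (h : IsDominatedKernel (weylKernel ħ b) decay A) (u : 𝓢(E d, ℂ)) :
    Integrable (fun p : E d × E d => weylKernel ħ b p.1 p.2 * u p.2) (volume.prod volume) := by
  have hu : Integrable (fun y => ‖u y‖) := u.integrable.norm
  have hA := h.nonneg
  refine ((integrable_decay.mul_prod hu).const_mul A).mono' ?_ (ae_of_all _ fun p => ?_)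
  · have := h.continuous
    have hu : Continuous u := u.continuous
    exact (this.mul (by fun_prop : Continuous fun p : E d × E d => u p.2)).aestronglyMeasurable
  · rw [norm_mul]
    have h0 := decay_nonneg p.1
    calc _ ≤ A * (decay p.1 * decay p.2) * ‖u p.2‖ := by gcongr; exact h.le _ _
      _ ≤ A * (decay p.1 * 1) * ‖u p.2‖ := by gcongr; exact decay_le_one _
      _ = _ := by ring

/-- The Fourier transform intertwines the Weyl operators of `b` and of its rotation. -/
theorem fourierL2_comp_weylL2 {b : E d × E d → ℂ} (hb : ContDiff ℝ ∞ b)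
    (hbc : HasCompactSupport b) {ħ : ℝ} (hħ : 0 < ħ) :
    (fourierL2 ħ).comp (weylL2 ħ b) = (weylL2 ħ (rotate b)).comp (fourierL2 ħ) := by
  obtain ⟨A, -, hA⟩ := exists_isDominatedKernel hb hbc
  obtain ⟨A', -, hA'⟩ :=
    exists_isDominatedKernel (contDiff_rotate hb) (hasCompactSupport_rotate hbc)
  replace hA := hA ħ hħ
  replace hA' := hA' ħ hħ
  refine ext_of_schwartz fun u => Lp.ext ?_
  simp only [ContinuousLinearMap.comp_apply]
  have hW := hA.weylL2_toLp_ae u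
  have hintW : Integrable (weylL2 ħ b (u.toLp 2 volume)) :=
    (hA.integrable_mul_schwartz u).integral_prod_left.congr hW.symm
  filter_upwards [fourierL2_ae_of_integrable hħ.ne' _ hintW,
    hA'.weylL2_ae (fourierL2 ħ (u.toLp 2 volume))] with ξ h1 h2
  rw [h1, h2]
  have hL : semiFourier ħ (weylL2 ħ b (u.toLp 2 volume)) ξ =
      ∫ y, (∫ x, Complex.exp (-(Complex.I / ħ) * (inner ℝ x ξ : ℝ)) * weylKernel ħ b x y) * u y := by
    have hint : Integrable (fun p : E d × E d =>
        Complex.exp (-(Complex.I / ħ) * (inner ℝ p.1 ξ : ℝ)) * (weylKernel ħ b p.1 p.2 * u p.2))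
        (volume.prod volume) := by
      refine (hA.integrable_mul_schwartz u).bdd_mul (c := 1) ?_
        (ae_of_all _ fun p => (norm_exp_neg_I_div _ _).le)
      exact Continuous.aestronglyMeasurable (by fun_prop)
    have h3 : semiFourier ħ (weylL2 ħ b (u.toLp 2 volume)) ξ =
        ∫ x, ∫ y, Complex.exp (-(Complex.I / ħ) * (inner ℝ x ξ : ℝ)) *
          (weylKernel ħ b x y * u y) := by
      refine integral_congr_ae ?_
      filter_upwards [hW] with x hx
      rw [hx, integral_const_mul]
    rw [h3, integral_integral_swap hint]
    refine integral_congr_ae (ae_of_all _ fun y => ?_)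
    simp only
    rw [← integral_mul_const]
    refine integral_congr_ae (ae_of_all _ fun x => ?_)
    simp only [mul_assoc]
  have hR : ∫ η, weylKernel ħ (rotate b) ξ η * fourierL2 ħ (u.toLp 2 volume) η =
      ∫ y, (∫ η, weylKernel ħ (rotate b) ξ η *
        Complex.exp (-(Complex.I / ħ) * (inner ℝ y η : ℝ))) * u y := by
    have hKη : Integrable (fun η => weylKernel ħ (rotate b) ξ η) := by
      refine (integrable_decay.const_mul (A' * (1 + ħ ^ (2 * (d + 1))) * (ħ ^ d)⁻¹ * decay ξ)).mono'
        (hA'.continuous.comp (by fun_prop : Continuous fun η => (ξ, η))).aestronglyMeasurable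
        (ae_of_all _ fun η => ?_)
      exact (hA'.le ξ η).trans_eq (by ring)
    have hint : Integrable (fun p : E d × E d =>
        Complex.exp (-(Complex.I / ħ) * (inner ℝ p.2 p.1 : ℝ)) *
          (weylKernel ħ (rotate b) ξ p.1 * u p.2)) (volume.prod volume) := by
      refine (hKη.mul_prod u.integrable).bdd_mul (c := 1) ?_
        (ae_of_all _ fun p => (norm_exp_neg_I_div _ _).le)
      exact Continuous.aestronglyMeasurable (by fun_prop)
    have h3 : ∫ η, weylKernel ħ (rotate b) ξ η * fourierL2 ħ (u.toLp 2 volume) η =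
        ∫ η, ∫ y, Complex.exp (-(Complex.I / ħ) * (inner ℝ y η : ℝ)) *
          (weylKernel ħ (rotate b) ξ η * u y) := by
      refine integral_congr_ae ?_
      filter_upwards [fourierL2_toLp_ae hħ.ne' u] with η hη
      rw [hη, semiFourier, ← integral_const_mul]
      refine integral_congr_ae (ae_of_all _ fun y => ?_)
      simp only
      ring
    rw [h3, integral_integral_swap hint]
    refine integral_congr_ae (ae_of_all _ fun y => ?_)
    simp only
    rw [← integral_mul_const]
    refine integral_congr_ae (ae_of_all _ fun x => ?_)
    simp only
    ring
  rw [hL, hR]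
  -- Both sides are now integrals of `u` against a kernel; the kernels agree by Fubini for
  -- `conjPhase`.
  simp_rw [integral_exp_mul_weylKernel, integral_weylKernel_rotate_mul_exp,
    integral_conjPhase_swap ħ hb.continuous hbc]

/-! ### Microlocal negligibility of localized operators -/

theorem one_add_pow_le_two {ħ : ℝ} (hħ : 0 < ħ) (h1 : ħ < 1) (n : ℕ) : 1 + ħ ^ n ≤ 2 := by
  have := pow_le_one₀ hħ.le h1.le (n := n)
  linarith

/-- A crude bound, losing `ħ^{-d}`, suffices: it only ever multiplies a factor of arbitrarily high
order in `ħ`. -/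
theorem exists_norm_weylL2_le {b : E d × E d → ℂ} (hb : ContDiff ℝ ∞ b)
    (hbc : HasCompactSupport b) :
    ∃ C : ℝ, 0 ≤ C ∧ ∀ ħ : ℝ, 0 < ħ → ħ < 1 → ‖weylL2 ħ b‖ ≤ C * (ħ ^ d)⁻¹ := by
  obtain ⟨A, hA0, hA⟩ := exists_isDominatedKernel hb hbc
  refine ⟨A * 2 * (eLpNorm (decay : E d → ℝ) 2 volume).toReal ^ 2, by positivity, fun ħ hħ h1 => ?_⟩
  rw [weylL2_eq (hA ħ hħ)]
  refine (norm_kernelOp_le _ (hA ħ hħ)).trans ?_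
  calc _ ≤ A * 2 * (ħ ^ d)⁻¹ * (eLpNorm (decay : E d → ℝ) 2 volume).toReal ^ 2 := by
        gcongr; exact one_add_pow_le_two hħ h1 _
    _ = _ := by ring

/-- If the kernel is nonzero, the midpoint lies in the base of the support of `b`. A point outside
`S` is at distance at least `r` from it, so `x` and `y` are at least `2r` apart and off-diagonal
decay applies. -/
theorem exists_norm_weylKernel_le_of_notMem {b : E d × E d → ℂ} (hb : ContDiff ℝ ∞ b)
    (hbc : HasCompactSupport b) {S : Set (E d)} {r : ℝ} (hr : 0 < r)
    (hS : ∀ z θ, b (z, θ) ≠ 0 → ∀ x ∉ S, r ≤ ‖x - z‖) (N : ℕ) :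
    ∃ C : ℝ, 0 ≤ C ∧ ∀ ħ : ℝ, 0 < ħ → ħ < 1 → ∀ x y, (x ∉ S ∨ y ∉ S) →
      ‖weylKernel ħ b x y‖ ≤ C * ħ ^ N * (decay x * decay y) := by
  obtain ⟨A, hA0, hA⟩ := exists_norm_weylKernel_le hb hbc (N + d) hr
  refine ⟨A * 2, by positivity, fun ħ hħ h1 x y hxy => ?_⟩
  have hx0 := decay_nonneg x
  have hy0 := decay_nonneg y
  by_cases hz : ∀ θ, b ((1 / 2 : ℝ) • (x + y), θ) = 0
  · rw [weylKernel_eq_zero hz, norm_zero]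
    positivity
  push Not at hz
  obtain ⟨θ, hθ⟩ := hz
  have hle : r ≤ ‖x - y‖ := by
    have h2 : x - (1 / 2 : ℝ) • (x + y) = (1 / 2 : ℝ) • (x - y) := by module
    have h3 : y - (1 / 2 : ℝ) • (x + y) = -((1 / 2 : ℝ) • (x - y)) := by module
    have h4 : ‖(1 / 2 : ℝ) • (x - y)‖ = 1 / 2 * ‖x - y‖ := by
      rw [norm_smul, Real.norm_of_nonneg (by norm_num)]
    have h5 : r ≤ 1 / 2 * ‖x - y‖ := by
      rcases hxy with h | h
      · have := hS _ _ hθ x h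
        rwa [h2, h4] at this
      · have := hS _ _ hθ y h
        rwa [h3, norm_neg, h4] at this
    linarith [norm_nonneg (x - y)]
  refine (hA ħ hħ x y (pow_le_pow_left₀ hr.le hle _)).trans ?_
  calc _ ≤ A * 2 * ħ ^ (N + d) * (ħ ^ d)⁻¹ * (decay x * decay y) := by
        gcongr; exact one_add_pow_le_two hħ h1 _
    _ = _ := by
        rw [pow_add]
        field_simp

theorem exists_norm_cutOp_comp_weylL2_le {b : E d × E d → ℂ} (hb : ContDiff ℝ ∞ b)
    (hbc : HasCompactSupport b) {S : Set (E d)} (hSm : MeasurableSet S) {r : ℝ} (hr : 0 < r)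
    (hS : ∀ z θ, b (z, θ) ≠ 0 → ∀ x ∉ S, r ≤ ‖x - z‖) (N : ℕ) :
    ∃ C : ℝ, 0 ≤ C ∧ ∀ ħ : ℝ, 0 < ħ → ħ < 1 →
      ‖(cutOp hSm.compl).comp (weylL2 ħ b)‖ ≤ C * ħ ^ N ∧
      ‖(weylL2 ħ b).comp (cutOp hSm.compl)‖ ≤ C * ħ ^ N := by
  obtain ⟨A, hA0, hA⟩ := exists_isDominatedKernel hb hbc
  obtain ⟨C, hC0, hC⟩ := exists_norm_weylKernel_le_of_notMem hb hbc hr hS N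
  refine ⟨C * (eLpNorm (decay : E d → ℝ) 2 volume).toReal ^ 2, by positivity, fun ħ hħ h1 => ?_⟩
  rw [weylL2_eq (hA ħ hħ)]
  constructor
  · refine (norm_cutOp_comp_kernelOp_le (C' := C * ħ ^ N) _ hSm.compl (by positivity)
      fun x hx y => hC ħ hħ h1 x y (Or.inl hx)).trans_eq (by ring)
  · refine (norm_kernelOp_comp_cutOp_le (C' := C * ħ ^ N) _ hSm.compl (by positivity)
      fun x y hy => hC ħ hħ h1 x y (Or.inr hy)).trans_eq (by ring)

/-- An operator which vanishes when localized to `S` on both sides is negligible between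
Weyl operators whose symbols are localized in the interior of `S`. -/
theorem exists_norm_weylL2_comp_le {a b : E d × E d → ℂ} (ha : ContDiff ℝ ∞ a)
    (hac : HasCompactSupport a) (hb : ContDiff ℝ ∞ b)
    (hbc : HasCompactSupport b) {S : Set (E d)} (hSm : MeasurableSet S) {r : ℝ} (hr : 0 < r)
    (haS : ∀ z θ, a (z, θ) ≠ 0 → ∀ x ∉ S, r ≤ ‖x - z‖)
    (hbS : ∀ z θ, b (z, θ) ≠ 0 → ∀ x ∉ S, r ≤ ‖x - z‖)
    {T : L2 d →L[ℂ] L2 d} (hT : (cutOp hSm).comp (T.comp (cutOp hSm)) = 0) (N : ℕ) :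
    ∃ C : ℝ, 0 ≤ C ∧ ∀ ħ : ℝ, 0 < ħ → ħ < 1 →
      ‖(weylL2 ħ a).comp (T.comp (weylL2 ħ b))‖ ≤ C * ħ ^ N := by
  obtain ⟨Ca, hCa0, hCa⟩ := exists_norm_weylL2_le ha hac
  obtain ⟨Cb, hCb0, hCb⟩ := exists_norm_weylL2_le hb hbc
  obtain ⟨Da, hDa0, hDa⟩ := exists_norm_cutOp_comp_weylL2_le ha hac hSm hr haS (N + d)
  obtain ⟨Db, hDb0, hDb⟩ := exists_norm_cutOp_comp_weylL2_le hb hbc hSm hr hbS (N + d)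
  refine ⟨Ca * ‖T‖ * Db + Da * ‖T‖ * Cb, by positivity, fun ħ hħ h1 => ?_⟩
  -- Insert `1 = 1_S + 1_{Sᶜ}` on both sides of `T`. The term with `1_S` twice vanishes, and each
  -- remaining term contains a Weyl operator cut off to `Sᶜ`.
  have hdec : (weylL2 ħ a).comp (T.comp (weylL2 ħ b)) =
      ((weylL2 ħ a).comp (cutOp hSm)).comp (T.comp ((cutOp hSm.compl).comp (weylL2 ħ b))) +
      ((weylL2 ħ a).comp (cutOp hSm.compl)).comp (T.comp (weylL2 ħ b)) := by
    ext1 u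
    have e1 : ∀ v, v = cutOp hSm v + cutOp hSm.compl v := fun v => by
      rw [← _root_.add_apply, cutOp_add_cutOp_compl hSm, ContinuousLinearMap.id_apply]
    have e2 : cutOp hSm (T (cutOp hSm (weylL2 ħ b u))) = 0 := by
      have := congrArg (fun R : L2 d →L[ℂ] L2 d => R (weylL2 ħ b u)) hT
      simpa using this
    have e3 : cutOp hSm (T (weylL2 ħ b u)) = cutOp hSm (T (cutOp hSm.compl (weylL2 ħ b u))) := by
      conv_lhs => rw [e1 (weylL2 ħ b u), map_add, map_add, e2, zero_add]
    simp only [ContinuousLinearMap.comp_apply, _root_.add_apply]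
    rw [← e3, ← map_add, ← e1]
  have hS1 := norm_cutOp_le hSm
  have n1 : ‖(weylL2 ħ a).comp (cutOp hSm)‖ ≤ Ca * (ħ ^ d)⁻¹ := by
    refine (ContinuousLinearMap.opNorm_comp_le _ _).trans ?_
    exact (mul_le_of_le_one_right (norm_nonneg _) hS1).trans (hCa ħ hħ h1)
  rw [hdec]
  refine (norm_add_le _ _).trans ?_
  calc _ ≤ ‖(weylL2 ħ a).comp (cutOp hSm)‖ * (‖T‖ * ‖(cutOp hSm.compl).comp (weylL2 ħ b)‖) +
        ‖(weylL2 ħ a).comp (cutOp hSm.compl)‖ * (‖T‖ * ‖weylL2 ħ b‖) := by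
        refine add_le_add ?_ ?_
        · refine (ContinuousLinearMap.opNorm_comp_le _ _).trans ?_
          gcongr
          exact ContinuousLinearMap.opNorm_comp_le _ _
        · refine (ContinuousLinearMap.opNorm_comp_le _ _).trans ?_
          gcongr
          exact ContinuousLinearMap.opNorm_comp_le _ _
    _ ≤ (Ca * (ħ ^ d)⁻¹) * (‖T‖ * (Db * ħ ^ (N + d))) +
        (Da * ħ ^ (N + d)) * (‖T‖ * (Cb * (ħ ^ d)⁻¹)) := by
        gcongr
        · exact (hDb ħ hħ h1).1
        · exact (hDa ħ hħ h1).2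
        · exact hCb ħ hħ h1
    _ = _ := by
        rw [pow_add]
        field_simp

theorem exists_radius_of_mem_nhds {S : Set (E d)} {p : E d} (hS : S ∈ 𝓝 p) :
    ∃ r > 0, ∀ z ∈ Metric.ball p r, ∀ x ∉ S, r ≤ ‖x - z‖ := by
  obtain ⟨ε, hε, hεS⟩ := Metric.mem_nhds_iff.1 hS
  refine ⟨ε / 2, by positivity, fun z hz x hx => ?_⟩
  have h1 : ε ≤ dist x p := by
    by_contra! h
    exact hx (hεS h)
  have h2 := dist_triangle x z p
  rw [Metric.mem_ball] at hz
  rw [← dist_eq_norm]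
  linarith

/-- Polynomial growth of `c ħ` is absorbed by asking for `n` more powers of `ħ`. The frequency is
unrestricted, since `T` is already localized in position. -/
theorem microlocallyEq_of_localized {S : Set (E d)} (hSm : MeasurableSet S) {p : E d}
    (hS : S ∈ 𝓝 p) {T : L2 d →L[ℂ] L2 d} (hT : (cutOp hSm).comp (T.comp (cutOp hSm)) = 0)
    {A B : ℝ → L2 d →L[ℂ] L2 d} {c : ℝ → ℂ} {n : ℕ} {D : ℝ}
    (hc : ∀ ħ, 0 < ħ → ‖c ħ‖ ≤ D * (ħ ^ n)⁻¹)
    (hAB : ∀ ħ, 0 < ħ → A ħ - B ħ = c ħ • T) (x : E d) :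
    MicrolocallyEq A B (p, x) := by
  obtain ⟨r, hr, hrS⟩ := exists_radius_of_mem_nhds hS
  refine ⟨Metric.ball p r ×ˢ Set.univ, prod_mem_nhds (Metric.ball_mem_nhds p hr) Filter.univ_mem,
    fun a b ha hb => ⟨fun ħ => weylL2 ħ a, fun ħ => weylL2 ħ b, fun ħ hħ =>
      ⟨isGivenBy_weylL2 ha.1 ha.2.1 hħ, isGivenBy_weylL2 hb.1 hb.2.1 hħ⟩, fun N => ?_⟩⟩
  obtain ⟨C, hC0, hC⟩ := exists_norm_weylL2_comp_le ha.1 ha.2.1 hb.1 hb.2.1 hSm hr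
    (fun z θ h => hrS z (ha.2.2 (subset_tsupport _ h)).1)
    (fun z θ h => hrS z (hb.2.2 (subset_tsupport _ h)).1) hT (N + n)
  have hD : 0 ≤ D := by
    have := (norm_nonneg _).trans (hc 1 one_pos)
    simpa using this
  refine ⟨D * C, 1, one_pos, fun ħ hħ h1 => ?_⟩
  rw [hAB ħ hħ, ContinuousLinearMap.smul_comp, ContinuousLinearMap.comp_smul, norm_smul]
  calc _ ≤ (D * (ħ ^ n)⁻¹) * (C * ħ ^ (N + n)) := by
        gcongr
        · exact hc ħ hħ
        · exact hC ħ hħ h1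
    _ = _ := by
        rw [pow_add]
        field_simp

/-- The product is `‖F^* F‖`, and `F^* F` is the scalar `(2πħ)^d`. -/
theorem norm_mul_norm_fourierL2_le {ħ : ℝ} (hħ : 0 < ħ) (h1 : ħ < 1) :
    ‖ContinuousLinearMap.adjoint (fourierL2 (d := d) ħ)‖ * ‖fourierL2 (d := d) ħ‖ ≤
      (2 * Real.pi) ^ d := by
  rw [LinearIsometryEquiv.norm_map, ← ContinuousLinearMap.norm_adjoint_comp_self,
    adjoint_fourierL2_comp_self hħ.ne', norm_smul, Complex.norm_real,
    Real.norm_of_nonneg (by positivity), abs_of_pos hħ]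
  refine (mul_le_of_le_one_right (by positivity) ContinuousLinearMap.norm_id_le).trans ?_
  have := Real.pi_pos
  exact pow_le_pow_left₀ (by positivity) (mul_le_of_le_one_right (by positivity) h1.le) d

/-- `F^*` is the inverse of `F` up to a nonzero scalar, so the intertwining relation can be
inverted. -/
theorem weylL2_comp_adjoint_fourierL2 {b : E d × E d → ℂ} (hb : ContDiff ℝ ∞ b)
    (hbc : HasCompactSupport b) {ħ : ℝ} (hħ : 0 < ħ) :
    (weylL2 ħ b).comp (ContinuousLinearMap.adjoint (fourierL2 ħ)) =
      (ContinuousLinearMap.adjoint (fourierL2 ħ)).comp (weylL2 ħ (rotate b)) := by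
  set F := fourierL2 (d := d) ħ
  set F' := ContinuousLinearMap.adjoint F
  have h1 : ∀ u, F (weylL2 ħ b u) = weylL2 ħ (rotate b) (F u) := fun u =>
    congrArg (fun R : L2 d →L[ℂ] L2 d => R u) (fourierL2_comp_weylL2 hb hbc hħ)
  have h2 : ∀ u, F' (F u) = (((2 * Real.pi * |ħ|) ^ d : ℝ) : ℂ) • u := fun u =>
    congrArg (fun R : L2 d →L[ℂ] L2 d => R u) (adjoint_fourierL2_comp_self hħ.ne')
  have h3 : ∀ u, F (F' u) = (((2 * Real.pi * |ħ|) ^ d : ℝ) : ℂ) • u := fun u =>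
    congrArg (fun R : L2 d →L[ℂ] L2 d => R u) (fourierL2_comp_adjoint hħ.ne')
  have hκ : (((2 * Real.pi * |ħ|) ^ d : ℝ) : ℂ) ≠ 0 := by
    have : 0 < |ħ| := abs_pos.2 hħ.ne'
    exact_mod_cast (show (2 * Real.pi * |ħ|) ^ d ≠ 0 by positivity)
  ext1 u
  refine smul_right_injective _ hκ ?_
  simp only [ContinuousLinearMap.comp_apply]
  rw [← h2, h1, h3, map_smul, map_smul]

/-- Moving both Weyl operators through `F` and `F^*` rotates their symbols, turning localization in
frequency near `p` into localization in position near `p`. -/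
theorem microlocallyEq_of_localized_fourier {S : Set (E d)} (hSm : MeasurableSet S) {p : E d}
    (hS : S ∈ 𝓝 p) {T : L2 d →L[ℂ] L2 d} (hT : (cutOp hSm).comp (T.comp (cutOp hSm)) = 0)
    {A B : ℝ → L2 d →L[ℂ] L2 d} {c : ℝ → ℂ} {n : ℕ} {D : ℝ}
    (hc : ∀ ħ, 0 < ħ → ‖c ħ‖ ≤ D * (ħ ^ n)⁻¹)
    (hAB : ∀ ħ, 0 < ħ → A ħ - B ħ =
      c ħ • (ContinuousLinearMap.adjoint (fourierL2 ħ)).comp (T.comp (fourierL2 ħ))) (x : E d) :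
    MicrolocallyEq A B (x, p) := by
  obtain ⟨r, hr, hrS⟩ := exists_radius_of_mem_nhds hS
  refine ⟨Set.univ ×ˢ Metric.ball p r, prod_mem_nhds Filter.univ_mem (Metric.ball_mem_nhds p hr),
    fun a b ha hb => ⟨fun ħ => weylL2 ħ a, fun ħ => weylL2 ħ b, fun ħ hħ =>
      ⟨isGivenBy_weylL2 ha.1 ha.2.1 hħ, isGivenBy_weylL2 hb.1 hb.2.1 hħ⟩, fun N => ?_⟩⟩
  obtain ⟨C, hC0, hC⟩ := exists_norm_weylL2_comp_le (contDiff_rotate ha.1)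
    (hasCompactSupport_rotate ha.2.1) (contDiff_rotate hb.1) (hasCompactSupport_rotate hb.2.1) hSm hr
    (fun z θ h => hrS z (ha.2.2 (subset_tsupport a h : (-θ, z) ∈ tsupport a)).2)
    (fun z θ h => hrS z (hb.2.2 (subset_tsupport b h : (-θ, z) ∈ tsupport b)).2) hT (N + n)
  have hD : 0 ≤ D := by
    have := (norm_nonneg _).trans (hc 1 one_pos)
    simpa using this
  refine ⟨D * ((2 * Real.pi) ^ d * C), 1, one_pos, fun ħ hħ h1 => ?_⟩
  have e1 : (weylL2 ħ a).comp (((ContinuousLinearMap.adjoint (fourierL2 ħ)).comp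
      (T.comp (fourierL2 ħ))).comp (weylL2 ħ b)) =
      (ContinuousLinearMap.adjoint (fourierL2 ħ)).comp
        (((weylL2 ħ (rotate a)).comp (T.comp (weylL2 ħ (rotate b)))).comp (fourierL2 ħ)) := by
    ext1 u
    have h2 := congrArg (fun R : L2 d →L[ℂ] L2 d => R u) (fourierL2_comp_weylL2 hb.1 hb.2.1 hħ)
    have h3 := congrArg (fun R : L2 d →L[ℂ] L2 d => R (T (weylL2 ħ (rotate b) (fourierL2 ħ u))))
      (weylL2_comp_adjoint_fourierL2 ha.1 ha.2.1 hħ)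
    simp only [ContinuousLinearMap.comp_apply] at h2 h3 ⊢
    rw [h2, h3]
  rw [hAB ħ hħ, ContinuousLinearMap.smul_comp, ContinuousLinearMap.comp_smul, norm_smul, e1]
  have e2 : ‖(ContinuousLinearMap.adjoint (fourierL2 (d := d) ħ)).comp
        (((weylL2 ħ (rotate a)).comp (T.comp (weylL2 ħ (rotate b)))).comp (fourierL2 ħ))‖ ≤
      (2 * Real.pi) ^ d * (C * ħ ^ (N + n)) := by
    refine (ContinuousLinearMap.opNorm_comp_le _ _).trans ?_
    calc _ ≤ ‖ContinuousLinearMap.adjoint (fourierL2 (d := d) ħ)‖ *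
          (‖(weylL2 ħ (rotate a)).comp (T.comp (weylL2 ħ (rotate b)))‖ * ‖fourierL2 (d := d) ħ‖) := by
          gcongr
          exact ContinuousLinearMap.opNorm_comp_le _ _
      _ = (‖ContinuousLinearMap.adjoint (fourierL2 (d := d) ħ)‖ * ‖fourierL2 (d := d) ħ‖) *
          ‖(weylL2 ħ (rotate a)).comp (T.comp (weylL2 ħ (rotate b)))‖ := by ring
      _ ≤ _ := by
          gcongr
          · exact norm_mul_norm_fourierL2_le hħ h1
          · exact hC ħ hħ h1
  calc _ ≤ (D * (ħ ^ n)⁻¹) * ((2 * Real.pi) ^ d * (C * ħ ^ (N + n))) := by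
        gcongr
        exact hc ħ hħ
    _ = _ := by
        rw [pow_add]
        field_simp

/-! ### Geometry of the map `g` -/

variable {G : Matrix (Fin (d + 1)) (Fin (d + 1)) ℝ}

theorem sigma_zero (ξ : E d) : sigma ξ 0 = Real.sqrt (1 - ‖ξ‖ ^ 2) := rfl

theorem sigma_succ (ξ : E d) (j : Fin d) : sigma ξ j.succ = ξ j := rfl

theorem gMap_apply (ξ : E d) (j : Fin d) : gMap G ξ j = ∑ i, G i j.succ * sigma ξ i := rfl

theorem tilt_apply (x : E d) (i : Fin (d + 1)) : tilt G x i = ∑ j, G i j.succ * x j := by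
  simp [tilt, Matrix.mulVec, dotProduct, Fin.sum_univ_succ]

/-- `G` moves across as its transpose, and the vanishing coordinate of `X̃` removes coordinate `0`
of `Gᵀ σ(ξ)`. -/
theorem inner_tilt_sigma (x ξ : E d) : inner ℝ (tilt G x) (sigma ξ) = inner ℝ x (gMap G ξ) := by
  simp only [PiLp.inner_apply, tilt_apply, gMap_apply, RCLike.inner_apply, conj_trivial,
    Finset.mul_sum, Finset.sum_mul]
  rw [Finset.sum_comm]
  refine Finset.sum_congr rfl fun j _ => Finset.sum_congr rfl fun i _ => by ring

theorem continuous_sigma : Continuous (sigma : E d → E (d + 1)) := by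
  refine (PiLp.continuous_toLp 2 _).comp (continuous_pi fun i => ?_)
  refine Fin.cases ?_ (fun j => ?_) i
  · simp only [Fin.cons_zero]; fun_prop
  · simp only [Fin.cons_succ]; fun_prop

theorem continuous_gMap : Continuous (gMap G) := by
  refine (PiLp.continuous_toLp 2 _).comp (continuous_pi fun j => ?_)
  have := continuous_sigma (d := d)
  simp only [Matrix.mulVec, dotProduct]
  fun_prop

/-- The linear form `X ↦ det (X, G e₁, …, G e_d)`, whose kernel is the hyperplane `G P₀`. -/
def hyperForm (G : Matrix (Fin (d + 1)) (Fin (d + 1)) ℝ) (X : E (d + 1)) : ℝ :=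
  (G.updateCol 0 X).det

theorem hyperForm_eq_cramer (X : E (d + 1)) : hyperForm G X = G.cramer X 0 :=
  (Matrix.cramer_apply G X 0).symm

theorem hyperForm_add (X Y : E (d + 1)) : hyperForm G (X + Y) = hyperForm G X + hyperForm G Y := by
  simp [hyperForm_eq_cramer]

theorem continuous_hyperForm : Continuous (hyperForm G) := by
  unfold hyperForm
  refine Continuous.matrix_det (continuous_matrix fun i j => ?_)
  by_cases h : j = 0
  · subst h
    simp only [Matrix.updateCol_self]
    fun_prop
  · simp only [Matrix.updateCol_ne h]
    fun_prop

/-- By Cramer's rule the form is, up to `det G`, the coordinate `0` of `G⁻¹ X`; the other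
coordinates supply the preimage. -/
theorem mem_range_tilt_of_hyperForm_eq_zero (hG : G.det ≠ 0) {X : E (d + 1)}
    (hX : hyperForm G X = 0) : X ∈ Set.range (tilt G) := by
  rw [hyperForm_eq_cramer] at hX
  refine ⟨WithLp.toLp 2 fun j => (G.det)⁻¹ * G.cramer X j.succ, ?_⟩
  ext i
  have h1 := congrFun (Matrix.mulVec_cramer G X) i
  simp only [Matrix.mulVec, dotProduct, Fin.sum_univ_succ, hX, mul_zero, zero_add, Pi.smul_apply,
    smul_eq_mul] at h1
  rw [tilt_apply]
  simp only [mul_left_comm _ (G.det)⁻¹, ← Finset.mul_sum]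
  rw [h1, inv_mul_cancel_left₀ hG]

theorem norm_sigma_sq {ξ : E d} (h : ‖ξ‖ ≤ 1) : ∑ i, sigma ξ i ^ 2 = 1 := by
  rw [Fin.sum_univ_succ, sigma_zero, Real.sq_sqrt]
  · simp only [sigma_succ]
    rw [EuclideanSpace.real_norm_sq_eq]; ring
  · nlinarith [norm_nonneg ξ]

/-- The difference `σ(η) - σ(η')` is orthogonal to `G e₁, …, G e_d` because `g` agrees, and to `σ(η)
+ σ(η')` because both are unit vectors. When the sum lies off `G P₀` these vectors span, so the
difference vanishes. -/
theorem eq_of_gMap_eq {η η' : E d} (h : ‖η‖ ≤ 1) (h' : ‖η'‖ ≤ 1) (hg : gMap G η = gMap G η')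
    (hne : hyperForm G (sigma η) + hyperForm G (sigma η') ≠ 0) : η = η' := by
  rw [← hyperForm_add, hyperForm, ← Matrix.det_transpose] at hne
  have hZ : (fun i => sigma η i - sigma η' i) = 0 := by
    refine Matrix.eq_zero_of_mulVec_eq_zero hne ?_
    ext j
    refine Fin.cases ?_ (fun j => ?_) j
    · simp only [Matrix.mulVec, dotProduct, Matrix.transpose_apply, Matrix.updateCol_self,
        PiLp.add_apply, Pi.zero_apply]
      have : ∀ i, (sigma η i + sigma η' i) * (sigma η i - sigma η' i) =
        sigma η i ^ 2 - sigma η' i ^ 2 := fun i => by ring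
      simp_rw [this]
      rw [Finset.sum_sub_distrib, norm_sigma_sq h, norm_sigma_sq h', sub_self]
    · simp only [Matrix.mulVec, dotProduct, Matrix.transpose_apply, Pi.zero_apply,
        Matrix.updateCol_ne (Fin.succ_ne_zero j), mul_sub, Finset.sum_sub_distrib]
      rw [← gMap_apply, ← gMap_apply, hg, sub_self]
  ext j
  have := congrFun hZ j.succ
  simpa [sigma_succ, sub_eq_zero] using this

/-- The matrix of the differential of `g`. -/
def diffMatrix (G : Matrix (Fin (d + 1)) (Fin (d + 1)) ℝ) (η : E d) : Matrix (Fin d) (Fin d) ℝ :=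
  Matrix.of fun j k => G k.succ j.succ - G 0 j.succ * (η k / Real.sqrt (1 - ‖η‖ ^ 2))

theorem one_sub_norm_sq_pos {η : E d} (h : ‖η‖ < 1) : 0 < 1 - ‖η‖ ^ 2 := by
  nlinarith [norm_nonneg η]

theorem hasFDerivAt_gMap {η : E d} (h : ‖η‖ < 1) :
    HasFDerivAt (gMap G) (LinearMap.toContinuousLinearMap
      (Matrix.toEuclideanLin (diffMatrix G η))) η := by
  have hs := one_sub_norm_sq_pos h
  rw [← hasFDerivWithinAt_univ, hasFDerivWithinAt_euclidean]
  intro j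
  rw [hasFDerivWithinAt_univ]
  have h1 := HasFDerivAt.sqrt ((hasStrictFDerivAt_norm_sq η).hasFDerivAt.const_sub 1) hs.ne'
  have h2 : HasFDerivAt (fun ξ : E d => ∑ k : Fin d, G k.succ j.succ * ξ k)
      (∑ k : Fin d, G k.succ j.succ • (EuclideanSpace.proj k : E d →L[ℝ] ℝ)) η :=
    HasFDerivAt.fun_sum fun k _ =>
      ((EuclideanSpace.proj k : E d →L[ℝ] ℝ).hasFDerivAt).const_mul (G k.succ j.succ)
  have h3 := (h1.const_mul (G 0 j.succ)).add h2
  have h4 : (fun ξ => gMap G ξ j) = (fun ξ : E d => G 0 j.succ * Real.sqrt (1 - ‖ξ‖ ^ 2)) +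
      fun ξ => ∑ k : Fin d, G k.succ j.succ * ξ k := by
    ext ξ
    simp only [gMap_apply, Fin.sum_univ_succ, sigma_zero, sigma_succ, Pi.add_apply]
  rw [h4]
  refine h3.congr_fderiv ?_
  ext v
  simp [diffMatrix, Matrix.mulVec, dotProduct, sub_mul, Finset.sum_sub_distrib, PiLp.inner_apply,
    Finset.mul_sum]
  have : Real.sqrt (1 - ‖η‖ ^ 2) ≠ 0 := (Real.sqrt_pos.2 hs).ne'
  rw [neg_add_eq_sub]
  congr 1
  refine Finset.sum_congr rfl fun k _ => ?_
  field_simp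

/-- With `σ(η)` as column `0`, subtracting `η_k / s` times row `0` from row `k` clears the rest of
that column and leaves the transpose of the differential. -/
theorem sqrt_mul_det_diffMatrix {η : E d} (h : ‖η‖ < 1) :
    Real.sqrt (1 - ‖η‖ ^ 2) * (diffMatrix G η).det = hyperForm G (sigma η) := by
  have hs := (Real.sqrt_pos.2 (one_sub_norm_sq_pos h)).ne'
  set s := Real.sqrt (1 - ‖η‖ ^ 2) with hsdef
  let B : Matrix (Fin (d + 1)) (Fin (d + 1)) ℝ := Matrix.of fun i =>
    (Fin.cons (Fin.cons s fun j => G 0 j.succ)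
      (fun k => Fin.cons 0 fun j => (diffMatrix G η).transpose k j) : Fin (d + 1) → Fin (d + 1) → ℝ) i
  have h1 : (G.updateCol 0 (sigma η)).det = B.det := by
    refine Matrix.det_eq_of_forall_row_eq_smul_add_const
      (Fin.cons 0 fun k => η k / s) 0 rfl fun i j => ?_
    refine Fin.cases ?_ (fun k => ?_) i <;> refine Fin.cases ?_ (fun l => ?_) j
    · simp [B, sigma_zero, hsdef]
    · simp [B]
    · simp [B, sigma_succ, hs]
    · simp [B, diffMatrix, ← hsdef]
      ring
  rw [hyperForm, h1, Matrix.det_succ_column_zero, Fin.sum_univ_succ]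
  have h2 : B.submatrix (Fin.succAbove 0) Fin.succ = (diffMatrix G η).transpose := by
    ext k l; simp [B]
  rw [h2, Matrix.det_transpose]
  simp [B]

theorem sqrt_mul_det_fderiv_gMap {η : E d} (h : ‖η‖ < 1) :
    Real.sqrt (1 - ‖η‖ ^ 2) * (fderiv ℝ (gMap G) η).det = hyperForm G (sigma η) := by
  rw [(hasFDerivAt_gMap h).fderiv, ← sqrt_mul_det_diffMatrix h, ContinuousLinearMap.det,
    LinearMap.coe_toContinuousLinearMap]
  congr 1
  exact LinearMap.det_toLpLin _ _

/-! ### Change of variables along `g` -/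

/-- The part of the unit ball where `σ(η)` lies strictly on the side `ε` of `G P₀`. -/
def halfBall (G : Matrix (Fin (d + 1)) (Fin (d + 1)) ℝ) (ε : ℝ) : Set (E d) :=
  {η | ‖η‖ < 1 ∧ 0 < ε * hyperForm G (sigma η)}

theorem isOpen_halfBall (ε : ℝ) : IsOpen (halfBall G ε) := by
  have h : Continuous fun η : E d => ε * hyperForm G (sigma η) :=
    continuous_const.mul (continuous_hyperForm.comp continuous_sigma)
  exact (isOpen_lt continuous_norm continuous_const).inter (isOpen_lt continuous_const h)

theorem injOn_halfBall (ε : ℝ) : Set.InjOn (gMap G) (halfBall G ε) := by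
  intro η hη η' hη' h
  refine eq_of_gMap_eq hη.1.le hη'.1.le h fun h0 => ?_
  have := add_pos hη.2 hη'.2
  rw [← mul_add, h0, mul_zero] at this
  exact this.false

theorem det_ne_zero_of_hyperForm_ne_zero {η : E d} (h : ‖η‖ < 1)
    (h0 : hyperForm G (sigma η) ≠ 0) : (fderiv ℝ (gMap G) η).det ≠ 0 := by
  rw [← sqrt_mul_det_fderiv_gMap h] at h0
  exact right_ne_zero_of_mul h0

theorem hyperForm_ne_zero_of_mem {ε : ℝ} {η : E d} (h : η ∈ halfBall G ε) :
    hyperForm G (sigma η) ≠ 0 := fun h0 => by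
  have := h.2
  rw [h0, mul_zero] at this
  exact this.false

theorem hasFDerivWithinAt_gMap {s : Set (E d)} {ε : ℝ} (hs : s ⊆ halfBall G ε) :
    ∀ η ∈ s, HasFDerivWithinAt (gMap G) (fderiv ℝ (gMap G) η) s η := fun _ hη =>
  (hasFDerivAt_gMap (hs hη).1).differentiableAt.hasFDerivAt.hasFDerivWithinAt

theorem mem_halfBall_one_or_neg_one {η : E d} (h : ‖η‖ < 1) (h0 : hyperForm G (sigma η) ≠ 0) :
    η ∈ halfBall G 1 ∨ η ∈ halfBall G (-1) := by
  rcases lt_or_gt_of_ne h0 with h1 | h1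
  · exact Or.inr ⟨h, by linarith⟩
  · exact Or.inl ⟨h, by linarith⟩

theorem disjoint_halfBall : Disjoint (halfBall G 1) (halfBall G (-1)) := by
  rw [Set.disjoint_left]
  intro η h h'
  have h1 := h.2
  have h2 := h'.2
  linarith

theorem hyperForm_ne_zero (hG : G.det ≠ 0) {η : E d} (h : sigma η ∉ Set.range (tilt G)) :
    hyperForm G (sigma η) ≠ 0 := fun h0 => h (mem_range_tilt_of_hyperForm_eq_zero hG h0)

/-- The cut-off `χ`, restricted to the open unit ball. -/
def ballCutoff (χ : E d → ℝ) : E d → ℝ := (Metric.ball 0 1).indicator χ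

theorem ballCutoff_of_norm_lt (χ : E d → ℝ) {η : E d} (h : ‖η‖ < 1) : ballCutoff χ η = χ η :=
  Set.indicator_of_mem (by simpa using h) _

/-- Since `√(1 - ‖η‖²) ≤ 1`, `|det dg|` is at least `|hyperForm|` at `σ(η)`, which is bounded below
on the compact set `supp χ ∩ {‖η‖ ≤ 1}`. Compactness is why the cut-off condition includes the unit
sphere. -/
theorem IsCutoff.exists_sq_le_det (hG : G.det ≠ 0) {χ : E d → ℝ} (hχ : IsCutoff G χ) :
    ∃ C : ℝ≥0, ∀ η, ‖η‖ < 1 → χ η ^ 2 ≤ C * |(fderiv ℝ (gMap G) η).det| := by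
  have hcont : Continuous χ := hχ.1.continuous
  obtain ⟨X, hX⟩ := (isCompact_closedBall (0 : E d) 1).exists_bound_of_continuousOn hcont.continuousOn
  have hK : IsCompact (tsupport χ ∩ Metric.closedBall 0 1) :=
    (isCompact_closedBall (0 : E d) 1).inter_left (isClosed_tsupport χ)
  obtain ⟨D, hD⟩ := hK.exists_bound_of_continuousOn (f := fun η => (hyperForm G (sigma η))⁻¹)
    ((continuous_hyperForm.comp continuous_sigma).continuousOn.inv₀ fun η hη =>
      hyperForm_ne_zero hG (hχ.2 η hη.1 (by simpa using hη.2)))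
  refine ⟨(X ^ 2 * D).toNNReal, fun η hη => ?_⟩
  by_cases h0 : χ η = 0
  · rw [h0, zero_pow two_ne_zero]; positivity
  have h1 := hX η (by simpa using hη.le)
  have h2 := hD η ⟨subset_tsupport χ h0, by simpa using hη.le⟩
  have h3 : hyperForm G (sigma η) ≠ 0 :=
    hyperForm_ne_zero hG (hχ.2 η (subset_tsupport χ h0) hη.le)
  rw [norm_inv, Real.norm_eq_abs, inv_le_iff_one_le_mul₀ (abs_pos.2 h3),
    ← sqrt_mul_det_fderiv_gMap hη, abs_mul, abs_of_nonneg (Real.sqrt_nonneg _)] at h2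
  have hs : Real.sqrt (1 - ‖η‖ ^ 2) ≤ 1 := 
    Real.sqrt_le_iff.2 ⟨zero_le_one, by nlinarith [sq_nonneg ‖η‖]⟩
  have hdet := abs_nonneg (fderiv ℝ (gMap G) η).det
  have hD0 : 0 ≤ D := by
    by_contra! hneg
    nlinarith [mul_nonneg (Real.sqrt_nonneg (1 - ‖η‖ ^ 2)) hdet]
  rw [Real.coe_toNNReal _ (by positivity)]
  have h4 : 1 ≤ D * |(fderiv ℝ (gMap G) η).det| :=
    h2.trans (mul_le_mul_of_nonneg_left (mul_le_of_le_one_left hdet hs) hD0)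
  calc χ η ^ 2 = |χ η| ^ 2 := (sq_abs _).symm
    _ ≤ X ^ 2 := by gcongr; exact h1
    _ ≤ X ^ 2 * (D * |(fderiv ℝ (gMap G) η).det|) := le_mul_of_one_le_right (sq_nonneg X) h4
    _ = _ := by ring

theorem lintegral_halfBall_le (ε : ℝ) (f : E d → ℝ≥0∞) :
    ∫⁻ η in halfBall G ε, ENNReal.ofReal |(fderiv ℝ (gMap G) η).det| * f (gMap G η) ≤ ∫⁻ y, f y := by
  rw [← lintegral_image_eq_lintegral_abs_det_fderiv_mul volume (isOpen_halfBall ε).measurableSet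
    (hasFDerivWithinAt_gMap subset_rfl) (injOn_halfBall ε)]
  exact setLIntegral_le_lintegral _ _

/-- Change variables on each side of `G P₀`, where `g` is injective; the two sides account for the
factor `2` in the constant. -/
theorem IsCutoff.exists_isCompBounded (hG : G.det ≠ 0) {χ : E d → ℝ} (hχ : IsCutoff G χ) :
    ∃ C, IsCompBounded (ballCutoff χ) (gMap G) C := by
  obtain ⟨C, hC⟩ := hχ.exists_sq_le_det hG
  refine ⟨NNReal.sqrt (2 * C), hχ.1.continuous.measurable.indicator measurableSet_ball,
    continuous_gMap.measurable, fun f hf => ?_⟩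
  set w : E d → ℝ≥0∞ := fun η => ENNReal.ofReal |(fderiv ℝ (gMap G) η).det| * f (gMap G η)
  have hpt : ∀ η, ‖ballCutoff χ η‖ₑ ^ 2 * f (gMap G η) ≤
      C * ((halfBall G 1).indicator w η + (halfBall G (-1)).indicator w η) := by
    intro η
    by_cases h0 : ballCutoff χ η = 0
    · simp [h0]
    have hη : ‖η‖ < 1 := by simpa using Set.mem_of_indicator_ne_zero h0
    rw [ballCutoff_of_norm_lt χ hη] at h0 ⊢
    have h1 : ‖χ η‖ₑ ^ 2 * f (gMap G η) ≤ C * w η := by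
      have h2 : ‖χ η‖ₑ ^ 2 ≤ C * ENNReal.ofReal |(fderiv ℝ (gMap G) η).det| := by
        rw [← ofReal_norm, ← ENNReal.ofReal_pow (norm_nonneg _), ← ENNReal.ofReal_coe_nnreal,
          ← ENNReal.ofReal_mul C.coe_nonneg, Real.norm_eq_abs, sq_abs]
        exact ENNReal.ofReal_le_ofReal (hC η hη)
      calc _ ≤ C * ENNReal.ofReal |(fderiv ℝ (gMap G) η).det| * f (gMap G η) := by gcongr
        _ = _ := by rw [mul_assoc]
    refine h1.trans ?_
    gcongr
    rcases mem_halfBall_one_or_neg_one hη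
      (hyperForm_ne_zero hG (hχ.2 η (subset_tsupport χ h0) hη.le)) with h | h
    · rw [Set.indicator_of_mem h]; exact le_self_add
    · rw [Set.indicator_of_mem h (f := w)]; exact le_add_self
  refine (lintegral_mono hpt).trans ?_
  have hwm : Measurable w := by
    refine Measurable.mul (ENNReal.measurable_ofReal.comp ?_) (hf.comp continuous_gMap.measurable)
    exact (ContinuousLinearMap.continuous_det.measurable.comp (measurable_fderiv ℝ (gMap G))).abs
  rw [lintegral_const_mul' _ _ ENNReal.coe_ne_top,
    lintegral_add_left (hwm.indicator (isOpen_halfBall 1).measurableSet),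
    lintegral_indicator (isOpen_halfBall 1).measurableSet,
    lintegral_indicator (isOpen_halfBall (-1)).measurableSet]
  have h5 : ((NNReal.sqrt (2 * C) : ℝ≥0) : ℝ≥0∞) ^ 2 = 2 * C := by
    rw [← ENNReal.coe_pow, NNReal.sq_sqrt]; simp
  rw [h5]
  calc _ ≤ (C : ℝ≥0∞) * ((∫⁻ y, f y) + ∫⁻ y, f y) :=
        mul_le_mul' le_rfl (add_le_add (lintegral_halfBall_le 1 f) (lintegral_halfBall_le (-1) f))
    _ = _ := by ring

theorem measure_image_gMap_lt_top {s : Set (E d)} (hs : s ⊆ Metric.closedBall 0 1) :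
    volume (gMap G '' s) < ⊤ :=
  (measure_mono (Set.image_mono hs)).trans_lt
    ((isCompact_closedBall (0 : E d) 1).image continuous_gMap).measure_lt_top

theorem integrableOn_L2 (u : L2 d) {s : Set (E d)} (hs : volume s < ⊤) : IntegrableOn u s := by
  have : IsFiniteMeasure (volume.restrict s) := ⟨by simpa using hs⟩
  exact ((Lp.memLp u).restrict s).integrable (by norm_num)

theorem jac_mul_abs_det {η : E d} (h : ‖η‖ < 1) (h0 : hyperForm G (sigma η) ≠ 0) :
    |(fderiv ℝ (gMap G) η).det| * jac G η = 1 :=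
  mul_inv_cancel₀ (abs_ne_zero.2 (det_ne_zero_of_hyperForm_ne_zero h h0))

/-! ### The products `C C^*` and `C^* C` as multiplication operators -/

/-- The adjoint of `C` is a pushforward along `g` where `χ = 1` and `g` is injective. -/
theorem setIntegral_image_adjoint_compOp {χ : E d → ℝ} {C : ℝ≥0}
    (hC : IsCompBounded (ballCutoff χ) (gMap G) C) {S : Set (E d)} {ε : ℝ} (hSb : S ⊆ halfBall G ε)
    (hχ : ∀ η ∈ S, χ η = 1) {f : L2 d} (hf : ∀ᵐ η, η ∉ S → f η = 0) {A : Set (E d)}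
    (hA : MeasurableSet A) (hAS : A ⊆ S) :
    ∫ y in gMap G '' A, ContinuousLinearMap.adjoint (compOp hC) f y = ∫ η in A, f η := by
  have hinj : Set.InjOn (gMap G) S := (injOn_halfBall ε).mono hSb
  have him : MeasurableSet (gMap G '' A) :=
    measurable_image_of_fderivWithin hA (hasFDerivWithinAt_gMap (hAS.trans hSb)) (hinj.mono hAS)
  have himfin : volume (gMap G '' A) ≠ ⊤ :=
    (measure_image_gMap_lt_top fun η hη => by simpa using (hSb (hAS hη)).1.le).ne
  -- Test against the indicator of `g(A)`. Inside `S` its pullback is the indicator of `A` by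
  -- injectivity; other preimages lie outside `S`, where `f` vanishes.
  rw [← L2.inner_indicatorConstLp_one him himfin, ContinuousLinearMap.adjoint_inner_right,
    inner_eq_integral, ← integral_indicator hA]
  refine integral_congr_ae ?_
  filter_upwards [compOp_ae hC (indicatorConstLp 2 him himfin (1 : ℂ)), hf,
    hC.ae_comp (indicatorConstLp_coeFn (p := 2) (hs := him) (hμs := himfin) (c := (1 : ℂ)))]
    with η h1 h2 h3
  by_cases hη : η ∈ S
  · have hk : ballCutoff χ η = 1 := by
      rw [ballCutoff_of_norm_lt χ (hSb hη).1]; exact hχ η hη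
    rw [h1, h3 (by rw [hk]; exact one_ne_zero), hk]
    by_cases hηA : η ∈ A
    · rw [Set.indicator_of_mem (Set.mem_image_of_mem _ hηA), Set.indicator_of_mem hηA]
      simp
    · have : gMap G η ∉ gMap G '' A := by
        rintro ⟨η', h4, h6⟩
        exact hηA (hinj (hAS h4) hη h6 ▸ h4)
      rw [Set.indicator_of_notMem this, Set.indicator_of_notMem hηA]
      simp
  · rw [h2 hη, mul_zero, Set.indicator_of_notMem fun h => hη (hAS h)]

/-- Where `χ = 1`, the operator `C C^*` is the multiplication by `J`. -/
theorem abs_det_smul_adjoint_compOp {χ : E d → ℝ} {C : ℝ≥0}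
    (hC : IsCompBounded (ballCutoff χ) (gMap G) C) {S : Set (E d)} {ε : ℝ} (hSb : S ⊆ halfBall G ε)
    (hSm : MeasurableSet S) (hχ : ∀ η ∈ S, χ η = 1) {f : L2 d} (hf : ∀ᵐ η, η ∉ S → f η = 0) :
    ∀ᵐ η, η ∈ S → |(fderiv ℝ (gMap G) η).det| •
      ContinuousLinearMap.adjoint (compOp hC) f (gMap G η) = f η := by
  have hSball : S ⊆ Metric.closedBall 0 1 := fun η hη => by simpa using (hSb hη).1.le
  have hSfin : volume S < ⊤ := (measure_mono hSball).trans_lt measure_closedBall_lt_top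
  have hinj : Set.InjOn (gMap G) S := (injOn_halfBall ε).mono hSb
  have h1 := fun A (hA : MeasurableSet A) (hAS : A ⊆ S) =>
    setIntegral_image_adjoint_compOp hC hSb hχ hf hA hAS
  generalize ContinuousLinearMap.adjoint (compOp hC) f = ψ at h1 ⊢
  -- Both functions have the same integral over every measurable subset of `S`, after changing
  -- variables back from `g(A)`.
  have key : (fun η => |(fderiv ℝ (gMap G) η).det| • ψ (gMap G η)) =ᵐ[volume.restrict S] f := by
    refine Integrable.ae_eq_of_forall_setIntegral_eq _ _ ?_ (integrableOn_L2 f hSfin)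
      fun A hA _ => ?_
    · exact (integrableOn_image_iff_integrableOn_abs_det_fderiv_smul volume hSm
        (hasFDerivWithinAt_gMap hSb) hinj ψ).1 (integrableOn_L2 ψ (measure_image_gMap_lt_top hSball))
    · have hASsub : A ∩ S ⊆ S := Set.inter_subset_right
      rw [Measure.restrict_restrict hA, ← h1 _ (hA.inter hSm) hASsub,
        ← integral_image_eq_integral_abs_det_fderiv_smul volume (hA.inter hSm)
        (hasFDerivWithinAt_gMap (hASsub.trans hSb)) (hinj.mono hASsub) ψ]
  rwa [Filter.EventuallyEq, ae_restrict_iff' hSm] at key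

theorem cutOp_comp_sub_compOp_eq_zero {S : Set (E d)} (hS : MeasurableSet S)
    (T : L2 d →L[ℂ] L2 d) {m : E d → ℝ} {C : ℝ≥0} (hm : IsCompBounded m id C)
    (h : ∀ f : L2 d, (∀ᵐ η, η ∉ S → f η = 0) → ∀ᵐ η, η ∈ S → T f η = m η * f η) :
    (cutOp hS).comp ((T - compOp hm).comp (cutOp hS)) = 0 := by
  ext1 φ
  have hf : ∀ᵐ η, η ∉ S → cutOp hS φ η = 0 := by
    filter_upwards [cutOp_ae hS φ] with η hη hnot
    rw [hη, Set.indicator_of_notMem hnot]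
  simp only [ContinuousLinearMap.comp_apply, _root_.sub_apply, _root_.zero_apply]
  generalize cutOp hS φ = f at hf ⊢
  have h1 := h f hf
  generalize T f = w at h1 ⊢
  refine Lp.ext ?_
  filter_upwards [cutOp_ae hS (w - compOp hm f), Lp.coeFn_sub w (compOp hm f), compOp_ae hm f, h1,
    Lp.coeFn_zero ℂ 2 (volume : Measure (E d))] with η h2 h3 h4 h5 h6
  rw [h2, h6, Pi.zero_apply]
  by_cases hη : η ∈ S
  · rw [Set.indicator_of_mem hη, h3, Pi.sub_apply, h4, h5 hη, id, sub_self]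
  · rw [Set.indicator_of_notMem hη]

/-- If `χ = 1` near `ξ`, then `C C^*` is the multiplication by `J` near `ξ`. -/
theorem exists_localized_comp_adjoint (hG : G.det ≠ 0) {χ : E d → ℝ} {C : ℝ≥0}
    (hC : IsCompBounded (ballCutoff χ) (gMap G) C) {ξ : E d} (hξ : ‖ξ‖ < 1)
    (hσ : sigma ξ ∉ Set.range (tilt G)) (hχ : ∀ᶠ ζ in 𝓝 ξ, χ ζ = 1) {m : E d → ℝ} {C' : ℝ≥0}
    (hm : IsCompBounded m id C') (hmj : ∀ᶠ η in 𝓝 ξ, m η = jac G η) :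
    ∃ (S : Set (E d)) (hS : MeasurableSet S), S ∈ 𝓝 ξ ∧
      (cutOp hS).comp (((compOp hC).comp (ContinuousLinearMap.adjoint (compOp hC)) -
        compOp hm).comp (cutOp hS)) = 0 := by
  obtain ⟨ε, hε⟩ : ∃ ε, ξ ∈ halfBall G ε := by
    rcases mem_halfBall_one_or_neg_one hξ (hyperForm_ne_zero hG hσ) with h | h
    exacts [⟨_, h⟩, ⟨_, h⟩]
  -- Keeping `S` on one side of `G P₀` lets the cut-offs discard a possible second preimage, so `J`
  -- appears rather than `J̃`.
  obtain ⟨S, hSsub, hSo, hξS⟩ := eventually_nhds_iff.1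
    (((isOpen_halfBall ε).eventually_mem hε).and (hχ.and hmj))
  have hSb : S ⊆ halfBall G ε := fun η hη => (hSsub η hη).1
  have hSχ : ∀ η ∈ S, χ η = 1 := fun η hη => (hSsub η hη).2.1
  have hSm : ∀ η ∈ S, m η = jac G η := fun η hη => (hSsub η hη).2.2
  refine ⟨S, hSo.measurableSet, hSo.mem_nhds hξS,
    cutOp_comp_sub_compOp_eq_zero _ _ _ fun f hf => ?_⟩
  have key := abs_det_smul_adjoint_compOp hC hSb hSo.measurableSet hSχ hf
  rw [ContinuousLinearMap.comp_apply]
  generalize ContinuousLinearMap.adjoint (compOp hC) f = ψ at key ⊢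
  filter_upwards [compOp_ae hC ψ, key] with η h3 h5 hη
  have hk : ballCutoff χ η = 1 := by
    rw [ballCutoff_of_norm_lt χ (hSb hη).1, hSχ η hη]
  rw [h3, hk, hSm η hη, ← h5 hη, Complex.real_smul, ← mul_assoc, ← Complex.ofReal_mul,
    mul_comm (jac G η), jac_mul_abs_det (hSb hη).1 (hyperForm_ne_zero_of_mem (hSb hη))]

/-- The contribution of the side `ε` of `G P₀` to the sum `J̃`. -/
def jacPart (G : Matrix (Fin (d + 1)) (Fin (d + 1)) ℝ) (ε : ℝ) (y : E d) : ℝ :=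
  ∑ᶠ η ∈ {η : E d | η ∈ halfBall G ε ∧ gMap G η = y}, jac G η

theorem jacPart_gMap {ε : ℝ} {η : E d} (hη : η ∈ halfBall G ε) :
    jacPart G ε (gMap G η) = jac G η := by
  have : {η' : E d | η' ∈ halfBall G ε ∧ gMap G η' = gMap G η} = {η} := by
    ext η'
    refine ⟨fun h => injOn_halfBall ε h.1 hη h.2, fun h => ?_⟩
    rw [Set.mem_singleton_iff] at h
    subst h
    exact ⟨hη, rfl⟩
  rw [jacPart, this, finsum_mem_singleton]

theorem jacPart_of_notMem {ε : ℝ} {y : E d} (hy : y ∉ gMap G '' halfBall G ε) :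
    jacPart G ε y = 0 := by
  have : {η' : E d | η' ∈ halfBall G ε ∧ gMap G η' = y} = ∅ := by
    ext η'
    simp only [Set.mem_ofPred_eq, Set.mem_empty_iff_false, iff_false]
    exact fun h => hy ⟨η', h⟩
  rw [jacPart, this, finsum_mem_empty]

theorem subsingleton_fiber_halfBall (ε : ℝ) (y : E d) :
    {η : E d | η ∈ halfBall G ε ∧ gMap G η = y}.Subsingleton :=
  fun _ h _ h' => injOn_halfBall ε h.1 h'.1 (h.2.trans h'.2.symm)

/-- A fiber avoiding `G P₀` splits into its parts on the two sides, each with at most one point, so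
the finite sums add. -/
theorem jacSum_eq_add {y : E d}
    (h : ∀ η : E d, ‖η‖ < 1 → gMap G η = y → hyperForm G (sigma η) ≠ 0) :
    jacSum G y = jacPart G 1 y + jacPart G (-1) y := by
  rw [jacPart, jacPart, ← finsum_mem_union]
  · rw [jacSum]
    refine finsum_mem_congr (Set.ext fun η => ?_) fun _ _ => rfl
    constructor
    · rintro ⟨h1, h2⟩
      rcases mem_halfBall_one_or_neg_one h1 (h η h1 h2) with h3 | h3
      exacts [Or.inl ⟨h3, h2⟩, Or.inr ⟨h3, h2⟩]
    · rintro (⟨h1, h2⟩ | ⟨h1, h2⟩) <;> exact ⟨h1.1, h2⟩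
  · exact Set.disjoint_left.2 fun η h1 h2 => Set.disjoint_left.1 disjoint_halfBall h1.1 h2.1
  · exact (subsingleton_fiber_halfBall 1 y).finite
  · exact (subsingleton_fiber_halfBall (-1) y).finite

/-- Change of variables on one side of `G P₀`. -/
theorem integral_jacPart_mul (ε : ℝ) {A : Set (E d)} (hA : MeasurableSet A) {f : E d → ℂ}
    (hf : IntegrableOn (fun η => f (gMap G η)) (halfBall G ε ∩ gMap G ⁻¹' A)) :
    IntegrableOn (fun y => jacPart G ε y * f y) A ∧
      ∫ y in A, jacPart G ε y * f y = ∫ η in halfBall G ε ∩ gMap G ⁻¹' A, f (gMap G η) := by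
  set D := halfBall G ε ∩ gMap G ⁻¹' A with hD
  have hDsub : D ⊆ halfBall G ε := Set.inter_subset_left
  have hDm : MeasurableSet D :=
    (isOpen_halfBall ε).measurableSet.inter (continuous_gMap.measurable hA)
  have hinj : Set.InjOn (gMap G) D := (injOn_halfBall ε).mono hDsub
  have hpt : ∀ η ∈ D, |(fderiv ℝ (gMap G) η).det| • ((jacPart G ε (gMap G η) : ℂ) * f (gMap G η)) =
      f (gMap G η) := by
    intro η hη
    rw [jacPart_gMap (hDsub hη), Complex.real_smul, ← mul_assoc, ← Complex.ofReal_mul,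
      jac_mul_abs_det (hDsub hη).1 (hyperForm_ne_zero_of_mem (hDsub hη)), Complex.ofReal_one, one_mul]
  -- Points of `A` without a preimage on this side contribute nothing, so the integral over `A`
  -- reduces to one over the image.
  have hzero : ∀ y ∈ A \ gMap G '' D, (jacPart G ε y : ℂ) * f y = 0 := by
    rintro y ⟨hyA, hy⟩
    rw [jacPart_of_notMem, Complex.ofReal_zero, zero_mul]
    rintro ⟨η, hη, rfl⟩
    exact hy ⟨η, ⟨hη, hyA⟩, rfl⟩
  have hsub : gMap G '' D ⊆ A := by
    rintro _ ⟨η, hη, rfl⟩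
    exact hη.2
  have hint : IntegrableOn (fun y => (jacPart G ε y : ℂ) * f y) (gMap G '' D) := by
    rw [integrableOn_image_iff_integrableOn_abs_det_fderiv_smul volume hDm
      (hasFDerivWithinAt_gMap hDsub) hinj]
    exact hf.congr_fun (fun η hη => (hpt η hη).symm) hDm
  refine ⟨hint.of_forall_sdiff_eq_zero hA hzero, ?_⟩
  rw [setIntegral_eq_of_subset_of_forall_sdiff_eq_zero hA hsub hzero,
    integral_image_eq_integral_abs_det_fderiv_smul volume hDm (hasFDerivWithinAt_gMap hDsub) hinj]
  exact setIntegral_congr_fun hDm hpt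

/-- `C^* C` is the multiplication by `J̃` where `χ = 1` on the fibers of `g`. -/
theorem setIntegral_adjoint_comp {χ : E d → ℝ} {C : ℝ≥0}
    (hC : IsCompBounded (ballCutoff χ) (gMap G) C) {S : Set (E d)}
    (hχ : ∀ η : E d, ‖η‖ < 1 → gMap G η ∈ S → χ η = 1)
    (hσ : ∀ η : E d, ‖η‖ < 1 → gMap G η ∈ S → hyperForm G (sigma η) ≠ 0)
    (f : L2 d) {A : Set (E d)} (hA : MeasurableSet A) (hAS : A ⊆ S) (hAfin : volume A ≠ ⊤) :
    IntegrableOn (fun y => (jacSum G y : ℂ) * f y) A ∧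
    ∫ y in A, ContinuousLinearMap.adjoint (compOp hC) (compOp hC f) y =
      ∫ y in A, (jacSum G y : ℂ) * f y := by
  set u := indicatorConstLp 2 hA hAfin (1 : ℂ) with hu
  -- The integral of `C^*C f` over `A` is `⟨C 1_A, C f⟩`; as `χ = 1` over `A`, this is the integral
  -- of `f ∘ g` over the part of the ball mapped into `A`.
  have hae : (fun η => (starRingEnd ℂ) (compOp hC u η) * compOp hC f η) =ᵐ[volume]
      (Metric.ball (0 : E d) 1 ∩ gMap G ⁻¹' A).indicator (fun η => f (gMap G η)) := by
    filter_upwards [compOp_ae hC u, compOp_ae hC f,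
      hC.ae_comp (indicatorConstLp_coeFn (p := 2) (hs := hA) (hμs := hAfin) (c := (1 : ℂ)))]
      with η h1 h2 h3
    rw [h1, h2]
    by_cases hk : ballCutoff χ η = 0
    · rw [hk, Set.indicator_of_notMem]
      · simp
      · rintro ⟨h4, h5⟩
        have h6 : ‖η‖ < 1 := by simpa using h4
        rw [ballCutoff_of_norm_lt χ h6, hχ η h6 (hAS h5)] at hk
        exact one_ne_zero hk
    · have h6 : ‖η‖ < 1 := by simpa using Set.mem_of_indicator_ne_zero hk
      rw [hu, h3 hk]
      by_cases h5 : gMap G η ∈ A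
      · rw [Set.indicator_of_mem (show η ∈ Metric.ball (0 : E d) 1 ∩ gMap G ⁻¹' A from
          ⟨by simpa using h6, h5⟩), Set.indicator_of_mem h5, ballCutoff_of_norm_lt χ h6,
          hχ η h6 (hAS h5)]
        simp
      · rw [Set.indicator_of_notMem h5, Set.indicator_of_notMem
          (fun h : η ∈ Metric.ball (0 : E d) 1 ∩ gMap G ⁻¹' A => h5 h.2)]
        simp
  have hBm : MeasurableSet (Metric.ball (0 : E d) 1 ∩ gMap G ⁻¹' A) :=
    measurableSet_ball.inter (continuous_gMap.measurable hA)
  have hintB : IntegrableOn (fun η => f (gMap G η)) (Metric.ball (0 : E d) 1 ∩ gMap G ⁻¹' A) := by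
    rw [← integrable_indicator_iff hBm]
    exact (integrable_conj_mul _ _).congr hae
  have hBeq : Metric.ball (0 : E d) 1 ∩ gMap G ⁻¹' A =
      (halfBall G 1 ∩ gMap G ⁻¹' A) ∪ (halfBall G (-1) ∩ gMap G ⁻¹' A) := by
    ext η
    constructor
    · rintro ⟨h1, h2⟩
      have h3 : ‖η‖ < 1 := by simpa using h1
      rcases mem_halfBall_one_or_neg_one h3 (hσ η h3 (hAS h2)) with h | h
      exacts [Or.inl ⟨h, h2⟩, Or.inr ⟨h, h2⟩]
    · rintro (⟨h1, h2⟩ | ⟨h1, h2⟩) <;> exact ⟨by simpa using h1.1, h2⟩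
  rw [hBeq] at hintB
  have hp := integral_jacPart_mul 1 hA hintB.left_of_union
  have hn := integral_jacPart_mul (-1) hA hintB.right_of_union
  have hsum : ∀ y ∈ A, (jacPart G 1 y : ℂ) * f y + (jacPart G (-1) y : ℂ) * f y =
      (jacSum G y : ℂ) * f y := by
    intro y hy
    rw [jacSum_eq_add fun η h1 h2 => hσ η h1 (h2 ▸ hAS hy)]
    push_cast
    ring
  refine ⟨(hp.1.add hn.1).congr_fun hsum hA, ?_⟩
  rw [← L2.inner_indicatorConstLp_one hA hAfin, ContinuousLinearMap.adjoint_inner_right,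
    inner_eq_integral, integral_congr_ae hae, integral_indicator hBm, hBeq,
    setIntegral_union (Set.disjoint_left.2 fun η h1 h2 => Set.disjoint_left.1 disjoint_halfBall
      h1.1 h2.1) ((isOpen_halfBall (-1)).measurableSet.inter (continuous_gMap.measurable hA))
      hintB.left_of_union hintB.right_of_union, ← hp.2, ← hn.2, ← integral_add hp.1 hn.1]
  exact setIntegral_congr_fun hA hsum

/-- If `χ = 1` near the fiber of `g` over `g(ξ)`, then `C^* C` is the multiplication by `J̃`
near `g(ξ)`. -/
theorem exists_localized_adjoint_comp (hG : G.det ≠ 0) {χ : E d → ℝ} (hχ : IsCutoff G χ) {C : ℝ≥0}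
    (hC : IsCompBounded (ballCutoff χ) (gMap G) C) {p : E d}
    (hp : ∀ η : E d, ‖η‖ ≤ 1 → gMap G η = p → ∀ᶠ ζ in 𝓝 η, χ ζ = 1) {m : E d → ℝ} {C' : ℝ≥0}
    (hm : IsCompBounded m id C') (hmj : ∀ᶠ y in 𝓝 p, m y = jacSum G y) :
    ∃ (S : Set (E d)) (hS : MeasurableSet S), S ∈ 𝓝 p ∧
      (cutOp hS).comp (((ContinuousLinearMap.adjoint (compOp hC)).comp (compOp hC) -
        compOp hm).comp (cutOp hS)) = 0 := by
  -- The points of the closed ball near which `χ` is not identically `1` form a compact set whose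
  -- image is closed and misses `p`. Hence `χ = 1` on all fibers over a neighbourhood of `p`.
  have hK : IsCompact (Metric.closedBall (0 : E d) 1 \ interior {ζ | χ ζ = 1}) :=
    (isCompact_closedBall (0 : E d) 1).diff isOpen_interior
  have hpK : p ∉ gMap G '' (Metric.closedBall (0 : E d) 1 \ interior {ζ | χ ζ = 1}) := by
    rintro ⟨η, ⟨h1, h2⟩, h3⟩
    exact h2 (mem_interior_iff_mem_nhds.2 (hp η (by simpa using h1) h3))
  obtain ⟨S, hSsub, hSo, hpS⟩ := mem_nhds_iff.1 (Filter.inter_mem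
    ((hK.image continuous_gMap).isClosed.isOpen_compl.mem_nhds hpK)
    (Filter.inter_mem hmj (Metric.ball_mem_nhds p one_pos)))
  have hSχ : ∀ η : E d, ‖η‖ < 1 → gMap G η ∈ S → χ η = 1 := by
    intro η h1 h2
    by_contra h3
    refine (hSsub h2).1 ⟨η, ⟨by simpa using h1.le, fun h4 => h3 ?_⟩, rfl⟩
    have h5 : η ∈ {ζ | χ ζ = 1} := interior_subset h4
    exact h5
  -- Where `χ = 1` the point lies in the support of `χ`, which the cut-off condition keeps away from
  -- `G P₀`.
  have hSσ : ∀ η : E d, ‖η‖ < 1 → gMap G η ∈ S → hyperForm G (sigma η) ≠ 0 := by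
    intro η h1 h2
    refine hyperForm_ne_zero hG (hχ.2 η (subset_tsupport χ ?_) h1.le)
    rw [Function.mem_support, hSχ η h1 h2]
    exact one_ne_zero
  have hSfin : volume S < ⊤ :=
    (measure_mono fun y hy => (hSsub hy).2.2).trans_lt measure_ball_lt_top
  refine ⟨S, hSo.measurableSet, hSo.mem_nhds hpS,
    cutOp_comp_sub_compOp_eq_zero _ _ _ fun f _ => ?_⟩
  have hSm : ∀ y ∈ S, m y = jacSum G y := fun y hy => (hSsub hy).2.1
  have h1 := fun A (hA : MeasurableSet A) (hAS : A ⊆ S) =>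
    setIntegral_adjoint_comp hC hSχ hSσ f hA hAS ((measure_mono hAS).trans_lt hSfin).ne
  rw [ContinuousLinearMap.comp_apply]
  generalize ContinuousLinearMap.adjoint (compOp hC) (compOp hC f) = ψ at h1 ⊢
  have key : ψ =ᵐ[volume.restrict S] fun y => (jacSum G y : ℂ) * f y := by
    refine Integrable.ae_eq_of_forall_setIntegral_eq _ _ (integrableOn_L2 ψ hSfin)
      (h1 S hSo.measurableSet subset_rfl).1 fun A hA _ => ?_
    rw [Measure.restrict_restrict hA]
    exact (h1 _ (hA.inter hSo.measurableSet) Set.inter_subset_right).2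
  rw [Filter.EventuallyEq, ae_restrict_iff' hSo.measurableSet] at key
  filter_upwards [key] with y hy hyS
  rw [hy hyS, hSm y hyS]

/-! ### The operators `V` and `U` -/

/-- The constant `(2πħ)^{-d}`. -/
def fourierConst (d : ℕ) (ħ : ℝ) : ℂ := (((2 * Real.pi * ħ) ^ d : ℝ) : ℂ)⁻¹

theorem conj_fourierConst (ħ : ℝ) : (starRingEnd ℂ) (fourierConst d ħ) = fourierConst d ħ := by
  rw [fourierConst, map_inv₀, Complex.conj_ofReal]

theorem norm_fourierConst {ħ : ℝ} (hħ : 0 < ħ) :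
    ‖fourierConst d ħ‖ = ((2 * Real.pi) ^ d)⁻¹ * (ħ ^ d)⁻¹ := by
  rw [fourierConst, norm_inv, Complex.norm_real, Real.norm_of_nonneg (by positivity), mul_pow,
    mul_inv]

theorem fourierConst_smul_fourierL2_adjoint {ħ : ℝ} (hħ : 0 < ħ) (u : L2 d) :
    fourierConst d ħ • fourierL2 ħ (ContinuousLinearMap.adjoint (fourierL2 ħ) u) = u := by
  have h := congrArg (fun R : L2 d →L[ℂ] L2 d => R u) (fourierL2_comp_adjoint (d := d) hħ.ne')
  simp only [ContinuousLinearMap.comp_apply, _root_.smul_apply, ContinuousLinearMap.id_apply,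
    abs_of_pos hħ] at h
  rw [h, smul_smul, fourierConst, inv_mul_cancel₀, one_smul]
  exact_mod_cast (show (2 * Real.pi * ħ) ^ d ≠ 0 by positivity)

theorem adjoint_compOp_id {m : E d → ℝ} {C : ℝ≥0} (hm : IsCompBounded m id C) :
    ContinuousLinearMap.adjoint (compOp hm) = compOp hm := by
  ext1 v
  refine ext_inner_left ℂ fun u => ?_
  rw [ContinuousLinearMap.adjoint_inner_right, inner_eq_integral, inner_eq_integral]
  refine integral_congr_ae ?_
  filter_upwards [compOp_ae hm u, compOp_ae hm v] with x h1 h2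
  rw [h1, h2, map_mul, Complex.conj_ofReal, id]
  ring

/-- The operator `V_G χ` on `L²(ℝ^d)`. -/
def opVL2 {χ : E d → ℝ} {C : ℝ≥0} (hC : IsCompBounded (ballCutoff χ) (gMap G) C) (ħ : ℝ) :
    L2 d →L[ℂ] L2 d :=
  fourierConst d ħ • ContinuousLinearMap.adjoint ((compOp hC).comp (fourierL2 ħ))

/-- The operator `V_G χ F_ħ` on `L²(ℝ^d)`. -/
def opUL2 {χ : E d → ℝ} {C : ℝ≥0} (hC : IsCompBounded (ballCutoff χ) (gMap G) C) (ħ : ℝ) :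
    L2 d →L[ℂ] L2 d :=
  (opVL2 hC ħ).comp (fourierL2 ħ)

theorem opV_congr_ae {χ : E d → ℝ} {ħ : ℝ} {φ φ' : E d → ℂ} (h : φ =ᵐ[volume] φ') (x : E d) :
    opV G χ ħ φ x = opV G χ ħ φ' x := by
  unfold opV
  congr 1
  refine integral_congr_ae (ae_restrict_of_ae ?_)
  filter_upwards [h] with ξ hξ
  rw [hξ]

theorem integrable_ballCutoff_mul {χ : E d → ℝ} (hχ : Continuous χ) (φ : L2 d) :
    Integrable (fun η => (ballCutoff χ η : ℂ) * φ η) := by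
  have h1 : IntegrableOn (fun η => (χ η : ℂ) * φ η) (Metric.ball 0 1) :=
    (integrableOn_L2 φ measure_ball_lt_top).continuousOn_mul_of_subset
      (Complex.continuous_ofReal.comp hχ).continuousOn (isCompact_closedBall (0 : E d) 1)
      measurableSet_ball Metric.ball_subset_closedBall
  rw [← integrable_indicator_iff measurableSet_ball] at h1
  refine h1.congr (ae_of_all _ fun η => ?_)
  by_cases h : η ∈ Metric.ball (0 : E d) 1 <;> simp [ballCutoff, h]

/-- Proved on all of `L²`, so that it can be applied to a Fourier transform when treating `U`. -/
theorem opVL2_ae {χ : E d → ℝ} (hχ : Continuous χ) {C : ℝ≥0}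
    (hC : IsCompBounded (ballCutoff χ) (gMap G) C) {ħ : ℝ} (hħ : 0 < ħ) (φ : L2 d) :
    opVL2 hC ħ φ =ᵐ[volume] opV G χ ħ φ := by
  unfold opVL2
  rw [_root_.smul_apply]
  have h1 := adjoint_compOp_fourierL2_ae hħ.ne' hC φ (integrable_ballCutoff_mul hχ φ)
  generalize ContinuousLinearMap.adjoint ((compOp hC).comp (fourierL2 ħ)) φ = ψ at h1 ⊢
  filter_upwards [h1, Lp.coeFn_smul (fourierConst d ħ) ψ] with x h2 h3
  rw [h3, Pi.smul_apply, h2, smul_eq_mul, opV, fourierConst, ← integral_indicator measurableSet_ball]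
  congr 1
  refine integral_congr_ae (ae_of_all _ fun η => ?_)
  simp only [ballCutoff]
  by_cases h : η ∈ Metric.ball (0 : E d) 1
  · rw [Set.indicator_of_mem h, Set.indicator_of_mem h, inner_tilt_sigma]
  · rw [Set.indicator_of_notMem h, Set.indicator_of_notMem h]
    simp

theorem isGivenBy_opVL2 {χ : E d → ℝ} (hχ : Continuous χ) {C : ℝ≥0}
    (hC : IsCompBounded (ballCutoff χ) (gMap G) C) {ħ : ℝ} (hħ : 0 < ħ) :
    IsGivenBy (opVL2 hC ħ) (opV G χ ħ) := by
  intro u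
  filter_upwards [opVL2_ae hχ hC hħ (u.toLp 2 volume)] with x hx
  rw [hx, opV_congr_ae (u.coeFn_toLp 2 volume)]

theorem opV_semiFourier (χ : E d → ℝ) (ħ : ℝ) (u : E d → ℂ) (x : E d) :
    opV G χ ħ (semiFourier ħ u) x = opU G χ ħ u x := by
  unfold opV opU semiFourier
  congr 1
  refine integral_congr_ae (ae_of_all _ fun ξ => ?_)
  simp only
  rw [← mul_assoc, ← integral_const_mul]
  refine integral_congr_ae (ae_of_all _ fun y => ?_)
  simp only
  rw [Complex.ofReal_sub, mul_sub, sub_eq_add_neg, Complex.exp_add, neg_mul]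
  ring

theorem isGivenBy_opUL2 {χ : E d → ℝ} (hχ : Continuous χ) {C : ℝ≥0}
    (hC : IsCompBounded (ballCutoff χ) (gMap G) C) {ħ : ℝ} (hħ : 0 < ħ) :
    IsGivenBy (opUL2 hC ħ) (opU G χ ħ) := by
  intro u
  filter_upwards [opVL2_ae hχ hC hħ (fourierL2 ħ (u.toLp 2 volume))] with x hx
  rw [opUL2, ContinuousLinearMap.comp_apply, hx, opV_congr_ae (fourierL2_toLp_ae hħ.ne' u),
    opV_semiFourier]

theorem isGivenBy_smul_compOp {m : E d → ℝ} {C : ℝ≥0} (hm : IsCompBounded m id C) (c : ℂ) :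
    IsGivenBy (c • compOp hm) (opMul c m) := by
  intro u
  rw [_root_.smul_apply]
  filter_upwards [Lp.coeFn_smul c (compOp hm (u.toLp 2 volume)), compOp_ae hm (u.toLp 2 volume),
    u.coeFn_toLp 2 volume] with x h1 h2 h3
  rw [h1, Pi.smul_apply, h2, id, h3, smul_eq_mul, opMul]

theorem integrable_semiFourier {ħ : ℝ} (hħ : ħ ≠ 0) (u : 𝓢(E d, ℂ)) :
    Integrable (semiFourier ħ u) := by
  have h : (2 * Real.pi * ħ)⁻¹ ≠ 0 := by simp [Real.pi_ne_zero, hħ]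
  have h1 := (𝓕 u).integrable (μ := volume).comp_smul h
  refine h1.congr (ae_of_all _ fun ξ => ?_)
  simp only [semiFourier_eq, SchwartzMap.fourier_coe]

/-- The Fourier multiplier `c F_ħ⁻¹ m F_ħ` on `L²(ℝ^d)`. -/
def fourierMulL2 {m : E d → ℝ} {C : ℝ≥0} (hm : IsCompBounded m id C) (c : ℂ) (ħ : ℝ) :
    L2 d →L[ℂ] L2 d :=
  (c * fourierConst d ħ) • (ContinuousLinearMap.adjoint (fourierL2 ħ)).comp
    ((compOp hm).comp (fourierL2 ħ))

/-- A real multiplier is self-adjoint, so `F^* m = (m F)^*` and the integral formula for such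
adjoints applies. -/
theorem fourierMulL2_apply {m : E d → ℝ} {C : ℝ≥0} (hm : IsCompBounded m id C) (c : ℂ) (ħ : ℝ)
    (u : L2 d) : fourierMulL2 hm c ħ u = (c * fourierConst d ħ) •
      ContinuousLinearMap.adjoint ((compOp hm).comp (fourierL2 ħ)) (fourierL2 ħ u) := by
  rw [ContinuousLinearMap.adjoint_comp, adjoint_compOp_id]
  rfl

theorem isGivenBy_fourierMulL2 {m : E d → ℝ} {C : ℝ≥0} (hm : IsCompBounded m id C)
    (hmb : ∀ η, |m η| ≤ C) (c : ℂ) {ħ : ℝ} (hħ : 0 < ħ) :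
    IsGivenBy (fourierMulL2 hm c ħ) (opFourierMul ħ c m) := by
  intro u
  have hF := fourierL2_toLp_ae hħ.ne' u
  have hint : Integrable (fun η => (m η : ℂ) * fourierL2 ħ (u.toLp 2 volume) η) := by
    refine (Integrable.congr (integrable_semiFourier hħ.ne' u) hF.symm).bdd_mul (c := C)
      (Complex.measurable_ofReal.comp hm.measurable_weight).aestronglyMeasurable
      (ae_of_all _ fun η => ?_)
    rw [Complex.norm_real]
    exact hmb η
  have h1 := adjoint_compOp_fourierL2_ae hħ.ne' hm _ hint
  rw [fourierMulL2_apply]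
  generalize ContinuousLinearMap.adjoint ((compOp hm).comp (fourierL2 ħ))
    (fourierL2 ħ (u.toLp 2 volume)) = ψ at h1 ⊢
  filter_upwards [h1, Lp.coeFn_smul (c * fourierConst d ħ) ψ] with x h3 h4
  rw [h4, Pi.smul_apply, h3, smul_eq_mul, opFourierMul, semiFourierInv, fourierConst, mul_assoc]
  congr 2
  refine integral_congr_ae ?_
  filter_upwards [hF] with η hη
  rw [hη, id]

/-! ### Hilbert space algebra of `c (T F)^*` -/

section Compositions

variable {H : Type*} [NormedAddCommGroup H] [InnerProductSpace ℂ H] [CompleteSpace H]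
  (T F M : H →L[ℂ] H) {c : ℂ}

theorem adjoint_smul_adjoint (hc : (starRingEnd ℂ) c = c) (T : H →L[ℂ] H) :
    ContinuousLinearMap.adjoint (c • ContinuousLinearMap.adjoint T) = c • T := by
  rw [map_smulₛₗ, ContinuousLinearMap.adjoint_adjoint, hc]

theorem comp_adjoint_sub (hc : (starRingEnd ℂ) c = c) :
    (c • ContinuousLinearMap.adjoint (T.comp F)).comp
        (ContinuousLinearMap.adjoint (c • ContinuousLinearMap.adjoint (T.comp F))) -
      (c * c) • (ContinuousLinearMap.adjoint F).comp (M.comp F) =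
    (c * c) • (ContinuousLinearMap.adjoint F).comp
      (((ContinuousLinearMap.adjoint T).comp T - M).comp F) := by
  rw [adjoint_smul_adjoint hc, ContinuousLinearMap.adjoint_comp]
  ext1 u
  simp only [ContinuousLinearMap.comp_apply, _root_.sub_apply, _root_.smul_apply, map_smul, map_sub,
    smul_sub, smul_smul]

/-- The inner `F F^*` consumes one of the two factors `c`; the factor `1 * c` matches the shape of
`fourierMulL2` with coefficient `1`. -/
theorem comp_comp_adjoint_sub (hc : (starRingEnd ℂ) c = c)
    (hF : ∀ u, c • F (ContinuousLinearMap.adjoint F u) = u) :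
    ((c • ContinuousLinearMap.adjoint (T.comp F)).comp F).comp
        (ContinuousLinearMap.adjoint ((c • ContinuousLinearMap.adjoint (T.comp F)).comp F)) -
      (1 * c) • (ContinuousLinearMap.adjoint F).comp (M.comp F) =
    c • (ContinuousLinearMap.adjoint F).comp
      (((ContinuousLinearMap.adjoint T).comp T - M).comp F) := by
  rw [ContinuousLinearMap.adjoint_comp (c • _) F, adjoint_smul_adjoint hc,
    ContinuousLinearMap.adjoint_comp, one_mul]
  ext1 u
  have h : ∀ u, c • ContinuousLinearMap.adjoint F (ContinuousLinearMap.adjoint T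
      (F (ContinuousLinearMap.adjoint F u))) =
      ContinuousLinearMap.adjoint F (ContinuousLinearMap.adjoint T u) := fun u => by
    rw [← map_smul, ← map_smul, hF]
  simp only [ContinuousLinearMap.comp_apply, _root_.sub_apply, _root_.smul_apply, map_smul, map_sub,
    smul_sub, h]

/-- Here `F F^*` sits between `T` and `T^*` and cancels one `c`, so no Fourier transform survives:
the result is localized in position rather than in frequency. -/
theorem adjoint_comp_sub (hc : (starRingEnd ℂ) c = c)
    (hF : ∀ u, c • F (ContinuousLinearMap.adjoint F u) = u) :
    (ContinuousLinearMap.adjoint (c • ContinuousLinearMap.adjoint (T.comp F))).comp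
        (c • ContinuousLinearMap.adjoint (T.comp F)) - c • M =
    c • (T.comp (ContinuousLinearMap.adjoint T) - M) := by
  rw [adjoint_smul_adjoint hc, ContinuousLinearMap.adjoint_comp]
  ext1 u
  have h : ∀ u, c • T (F (ContinuousLinearMap.adjoint F u)) = T u := fun u => by
    rw [← map_smul, hF]
  simp only [ContinuousLinearMap.comp_apply, _root_.sub_apply, _root_.smul_apply, map_smul,
    smul_sub, h]

theorem adjoint_comp_comp_sub (hc : (starRingEnd ℂ) c = c)
    (hF : ∀ u, c • F (ContinuousLinearMap.adjoint F u) = u) :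
    (ContinuousLinearMap.adjoint ((c • ContinuousLinearMap.adjoint (T.comp F)).comp F)).comp
        ((c • ContinuousLinearMap.adjoint (T.comp F)).comp F) -
      (1 * c) • (ContinuousLinearMap.adjoint F).comp (M.comp F) =
    c • (ContinuousLinearMap.adjoint F).comp
      ((T.comp (ContinuousLinearMap.adjoint T) - M).comp F) := by
  rw [ContinuousLinearMap.adjoint_comp, adjoint_smul_adjoint hc, ContinuousLinearMap.adjoint_comp,
    one_mul]
  ext1 u
  have h : ∀ u, c • T (F (ContinuousLinearMap.adjoint F u)) = T u := fun u => by
    rw [← map_smul, hF]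
  simp only [ContinuousLinearMap.comp_apply, _root_.sub_apply, _root_.smul_apply, map_smul, map_sub,
    smul_sub, h]

end Compositions

theorem norm_fourierConst_mul_self {ħ : ℝ} (hħ : 0 < ħ) :
    ‖fourierConst d ħ * fourierConst d ħ‖ =
      (((2 * Real.pi) ^ d)⁻¹ * ((2 * Real.pi) ^ d)⁻¹) * (ħ ^ (d + d))⁻¹ := by
  rw [norm_mul, norm_fourierConst hħ, pow_add, mul_inv, mul_mul_mul_comm]

theorem exists_bound_of_isLocalVersion {j m : E d → ℝ} {ξ : E d} (h : IsLocalVersion j m ξ) :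
    ∃ C : ℝ≥0, ∀ η, |m η| ≤ C := by
  obtain ⟨-, ⟨M, hM⟩, -⟩ := h
  exact ⟨M.toNNReal, fun η => (hM η).trans (Real.le_coe_toNNReal M)⟩

/-! ### The four microlocal identities -/

section Microlocal

variable {χ : E d → ℝ} {C : ℝ≥0} (hC : IsCompBounded (ballCutoff χ) (gMap G) C) {m : E d → ℝ}
  {ξ : E d}

theorem isMicrolocally_opVL2_comp_adjoint (hG : G.det ≠ 0) (hχ : IsCutoff G χ)
    (h1 : ∀ η : E d, ‖η‖ ≤ 1 → gMap G η = ξ → ∀ᶠ ζ in 𝓝 η, χ ζ = 1)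
    (hm : IsLocalVersion (jacSum G) m ξ) (x : E d) :
    IsMicrolocally (fun ħ => (opVL2 hC ħ).comp (ContinuousLinearMap.adjoint (opVL2 hC ħ)))
      (fun ħ => opFourierMul ħ (fourierConst d ħ) m) (x, ξ) ∧
    IsMicrolocally (fun ħ => (opUL2 hC ħ).comp (ContinuousLinearMap.adjoint (opUL2 hC ħ)))
      (fun ħ => opFourierMul ħ 1 m) (x, ξ) := by
  obtain ⟨M, hM⟩ := exists_bound_of_isLocalVersion hm
  have hmC := isCompBounded_id hm.1 hM
  obtain ⟨S, hS, hSn, hT⟩ := exists_localized_adjoint_comp hG hχ hC h1 hmC hm.2.2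
  refine ⟨⟨fun ħ => fourierMulL2 hmC (fourierConst d ħ) ħ, fun ħ hħ =>
    isGivenBy_fourierMulL2 hmC hM _ hħ, ?_⟩, ⟨fun ħ => fourierMulL2 hmC 1 ħ, fun ħ hħ =>
    isGivenBy_fourierMulL2 hmC hM _ hħ, ?_⟩⟩
  · exact microlocallyEq_of_localized_fourier hS hSn hT
      (fun ħ hħ => (norm_fourierConst_mul_self hħ).le)
      (fun ħ _ => comp_adjoint_sub (compOp hC) (fourierL2 ħ) (compOp hmC) (conj_fourierConst ħ)) x
  · exact microlocallyEq_of_localized_fourier hS hSn hT (fun ħ hħ => (norm_fourierConst hħ).le)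
      (fun ħ hħ => comp_comp_adjoint_sub (compOp hC) (fourierL2 ħ) (compOp hmC)
        (conj_fourierConst ħ) (fourierConst_smul_fourierL2_adjoint hħ)) x

theorem isMicrolocally_adjoint_comp_opVL2 (hG : G.det ≠ 0) (hξ : ‖ξ‖ < 1)
    (hσ : sigma ξ ∉ Set.range (tilt G)) (h1 : ∀ᶠ ζ in 𝓝 ξ, χ ζ = 1)
    (hm : IsLocalVersion (jac G) m ξ) (x : E d) :
    IsMicrolocally (fun ħ => (ContinuousLinearMap.adjoint (opVL2 hC ħ)).comp (opVL2 hC ħ))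
      (fun ħ => opMul (fourierConst d ħ) m) (ξ, x) ∧
    IsMicrolocally (fun ħ => (ContinuousLinearMap.adjoint (opUL2 hC ħ)).comp (opUL2 hC ħ))
      (fun ħ => opFourierMul ħ 1 m) (x, ξ) := by
  obtain ⟨M, hM⟩ := exists_bound_of_isLocalVersion hm
  have hmC := isCompBounded_id hm.1 hM
  obtain ⟨S, hS, hSn, hT⟩ := exists_localized_comp_adjoint hG hC hξ hσ h1 hmC hm.2.2
  refine ⟨⟨fun ħ => fourierConst d ħ • compOp hmC, fun ħ _ => isGivenBy_smul_compOp hmC _, ?_⟩,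
    ⟨fun ħ => fourierMulL2 hmC 1 ħ, fun ħ hħ => isGivenBy_fourierMulL2 hmC hM _ hħ, ?_⟩⟩
  · exact microlocallyEq_of_localized hS hSn hT (fun ħ hħ => (norm_fourierConst hħ).le)
      (fun ħ hħ => adjoint_comp_sub (compOp hC) (fourierL2 ħ) (compOp hmC)
        (conj_fourierConst ħ) (fourierConst_smul_fourierL2_adjoint hħ)) x
  · exact microlocallyEq_of_localized_fourier hS hSn hT (fun ħ hħ => (norm_fourierConst hħ).le)
      (fun ħ hħ => adjoint_comp_comp_sub (compOp hC) (fourierL2 ħ) (compOp hmC)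
        (conj_fourierConst ħ) (fourierConst_smul_fourierL2_adjoint hħ)) x

end Microlocal

end AngularSpectrum

end

open AngularSpectrum
theorem mainTheorem7 (d : ℕ) (G : Matrix.GeneralLinearGroup (Fin (d + 1)) ℝ)
    (χ : E d → ℝ) (hχ : IsCutoff G.val χ) :
    ∃ V U : ℝ → L2 d →L[ℂ] L2 d,
      (∀ ħ : ℝ, 0 < ħ →
        IsGivenBy (V ħ) (opV G.val χ ħ) ∧ IsGivenBy (U ħ) (opU G.val χ ħ)) ∧
      ∀ ξ : E d, ‖ξ‖ < 1 → sigma ξ ∉ Set.range (tilt G.val) →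
        ((∀ η : E d, ‖η‖ ≤ 1 → gMap G.val η = gMap G.val ξ → ∀ᶠ ζ in 𝓝 η, χ ζ = 1) →
          ∀ m : E d → ℝ, IsLocalVersion (jacSum G.val) m (gMap G.val ξ) → ∀ x : E d,
            IsMicrolocally (fun ħ => (V ħ).comp (ContinuousLinearMap.adjoint (V ħ)))
              (fun ħ => opFourierMul ħ (((2 * Real.pi * ħ) ^ d : ℝ) : ℂ)⁻¹ m)
              (x, gMap G.val ξ) ∧
            IsMicrolocally (fun ħ => (U ħ).comp (ContinuousLinearMap.adjoint (U ħ)))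
              (fun ħ => opFourierMul ħ 1 m) (x, gMap G.val ξ)) ∧
        ((∀ᶠ ζ in 𝓝 ξ, χ ζ = 1) →
          ∀ m : E d → ℝ, IsLocalVersion (jac G.val) m ξ → ∀ x : E d,
            IsMicrolocally (fun ħ => (ContinuousLinearMap.adjoint (V ħ)).comp (V ħ))
              (fun ħ => opMul (((2 * Real.pi * ħ) ^ d : ℝ) : ℂ)⁻¹ m) (ξ, x) ∧
            IsMicrolocally (fun ħ => (ContinuousLinearMap.adjoint (U ħ)).comp (U ħ))
              (fun ħ => opFourierMul ħ 1 m) (x, ξ)) := by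
  have hG : G.val.det ≠ 0 := G.det_ne_zero
  obtain ⟨C, hC⟩ := hχ.exists_isCompBounded hG
  exact ⟨opVL2 hC, opUL2 hC, fun ħ hħ =>
    ⟨isGivenBy_opVL2 hχ.1.continuous hC hħ, isGivenBy_opUL2 hχ.1.continuous hC hħ⟩,
    fun ξ hξ hσ => ⟨fun h1 m hm x => isMicrolocally_opVL2_comp_adjoint hC hG hχ h1 hm x,
      fun h1 m hm x => isMicrolocally_adjoint_comp_opVL2 hC hG hξ hσ h1 hm x⟩⟩
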